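/- Let $\mathrm{sOp}$ be the $\mathbb{N}$-coloured symmetric operad in sets whose algebras are the one-coloured symmetric operads. Its operations with input colours $c_1,\dots,c_n$ and output colour $m$ are the operadic trees: isomorphism classes of planar rooted trees with half-edges, with $n$ vertices indexed bijectively by $\{1,\dots,n\}$, the $i$-th vertex having $c_i\geq 0$ input edges, and with $m$ input leaves indexed by an arbitrary bijection with an $m$-element index set. Composition substitutes trees into vertices, identities are corollas with leaves indexed in planar order, and the symmetric groups renumber vertices. Let $\mathrm{nusOp}$ be the suboperad of operations of non-zero arity (trees with at least one vertex). For a coloured symmetric set-operad $P$, let $\mathcal{C}(P)$ be the category whose objects are the operations of $P$ and whose morphisms $q\to p$ are the 2-level trees with lowest vertex marked by $p$, with upper vertices marked by operations $q_i$ of $P$ (one for each input of $p$), and with the input leaves, all adjacent to upper vertices, indexed by a permutation so that the indices of the leaves above each upper vertex increase in planar order, such that $q$ is the composition of $p$ with the $q_i$, permuted by the permutation on leaves. Composition is given by grafting 2-level trees and composing the subtrees above the lowest vertex. A small category $\mathcal{G}$ is Gröbner if for each object $c$: (G1) there are well-orders on the sets $\mathrm{Hom}(c,d)$, for all objects $d$,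 such that $f\prec f'$ implies $g\circ f\prec g\circ f'$ for all $f,f':c\to d$ and $g:d\to d'$; and (G2) in the poset generated by the preorder on all morphisms from $c$, where $f\leq g$ iff $g=h\circ f$ for some $h$, every infinite sequence $x_1,x_2,\dots$ has $x_i\leq x_j$ for some $i<j$. A functor $\Phi:\mathcal{G}\to\mathcal{D}$ has property (F) if for each object $d$ of $\mathcal{D}$ there are finitely many objects $c_1,\dots,c_n$ of $\mathcal{G}$ and morphisms $f_i:d\to\Phi(c_i)$ such that each morphism $f:d\to\Phi(c)$, for any object $c$ of $\mathcal{G}$, equals $\Phi(g)\circ f_i$ for some $i$ and some $g:c_i\to c$. A category $\mathcal{D}$ is quasi-Gröbner if there is an essentially surjective functor with property (F) from a Gröbner category to $\mathcal{D}$. **Theorem.** The category $\mathcal{C}(\mathrm{nusOp})^{op}$ is quasi-Gröbner. -/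

import Mathlib

open CategoryTheory

universe u v

/-! ### Gröbner and quasi-Gröbner categories -/

section Grobner

variable {C : Type u} [Category.{v} C]

/-- (G1) at `c`: an admissible order on the morphisms from `c`, i.e. well-orders (given by their
strict parts) on the sets `c ⟶ d`, for all `d`, that are strictly preserved by postcomposition. -/
def HasAdmissibleOrder (c : C) : Prop :=
  ∃ lt : ∀ d : C, (c ⟶ d) → (c ⟶ d) → Prop,
    (∀ d, IsWellOrder (c ⟶ d) (lt d)) ∧
    ∀ (d d' : C) (f f' : c ⟶ d) (g : d ⟶ d'), lt d f f' → lt d' (f ≫ g) (f' ≫ g)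

/-- The set of all morphisms with source `c`. -/
structure MorphismsFrom (c : C) : Type (max u v) where
  target : C
  hom : c ⟶ target

/-- The canonical preorder: `f ≤ g` iff `g = h ∘ f` for some `h`. -/
instance (c : C) : Preorder (MorphismsFrom c) where
  le f g := ∃ h : f.target ⟶ g.target, f.hom ≫ h = g.hom
  le_refl f := ⟨𝟙 _, Category.comp_id _⟩
  le_trans _ _ _ := fun ⟨h, hh⟩ ⟨k, hk⟩ => ⟨h ≫ k, by rw [← Category.assoc, hh, hk]⟩

/-- The poset `|c/C|` generated by the preorder of morphisms from `c`. -/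
abbrev UnderPoset (c : C) : Type (max u v) :=
  Antisymmetrization (MorphismsFrom c) (· ≤ ·)

/-- A poset is Noetherian if every sequence `x` in it has `x i ≤ x j` for some `i < j`. -/
def IsNoetherianPoset (X : Type u) [PartialOrder X] : Prop :=
  ∀ x : ℕ → X, ∃ i j : ℕ, i < j ∧ x i ≤ x j

variable (C) in
/-- Gröbner categories: conditions (G1) and (G2) hold at every object. -/
def IsGrobner : Prop :=
  ∀ c : C, HasAdmissibleOrder c ∧ IsNoetherianPoset (UnderPoset c)

/-- Property (F) of a functor `Φ`. -/
def PropertyF {D : Type*} [Category* D] (Φ : C ⥤ D) : Prop :=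
  ∀ d : D, ∃ (n : ℕ) (c : Fin n → C) (f : ∀ i, d ⟶ Φ.obj (c i)),
    ∀ (c' : C) (g : d ⟶ Φ.obj c'), ∃ (i : Fin n) (h : c i ⟶ c'), f i ≫ Φ.map h = g

end Grobner

/-- A (small) category is quasi-Gröbner if it receives an essentially surjective functor with
property (F) from a (small) Gröbner category. -/
def IsQuasiGrobner (D : Type u) [SmallCategory D] : Prop :=
  ∃ (C : Type u) (_ : SmallCategory C) (Φ : C ⥤ D),
    IsGrobner C ∧ Φ.EssSurj ∧ PropertyF Φ

/-! ### Coloured symmetric operads in sets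

Operads are given in the coordinate-free form: the inputs of an operation are indexed by an
arbitrary finite set `I` instead of `{1, …, n}`, and the symmetric group actions become relabelling
along colour-preserving bijections of finite sets. -/

/-- The identification of the inputs of `id ∘ p` with the inputs of `p`. -/
def unitSigmaEquiv (I : Type) : (Σ _ : Unit, I) ≃ I where
  toFun x := x.2
  invFun i := ⟨(), i⟩

/-- The fibre of the identity map over `i` has one element. -/
def fibreIdEquiv {I : Type} (i : I) : Unit ≃ {j : I // j = i} where
  toFun _ := ⟨i, rfl⟩
  invFun _ := ()
  left_inv _ := rfl
  right_inv := by rintro ⟨j, rfl⟩; rfl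

/-- For maps `g : K → J` and `f : J → I`, the fibre of `f ∘ g` over `i` is the union of the fibres
of `g` over the elements of the fibre of `f` over `i`. -/
def fibreCompEquiv {K J I : Type} (g : K → J) (f : J → I) (i : I) :
    (Σ j : {j : J // f j = i}, {k : K // g k = j.1}) ≃ {k : K // f (g k) = i} where
  toFun x := ⟨x.2.1, by rw [x.2.2]; exact x.1.2⟩
  invFun k := ⟨⟨g k.1, k.2⟩, ⟨k.1, rfl⟩⟩
  left_inv x := Sigma.subtype_ext (Subtype.ext x.2.2) rfl
  right_inv _ := rfl

section Colours

variable {C : Type u} {I I' : Type} {J : I → Type}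

theorem colour_refl (c : I → C) (i : I) : c (Equiv.refl I i) = c i := rfl

theorem colour_trans {I'' : Type} {c : I → C} {c' : I' → C} {c'' : I'' → C} {e : I ≃ I'}
    (h : ∀ i, c' (e i) = c i) {e' : I' ≃ I''} (h' : ∀ i, c'' (e' i) = c' i) (i : I) :
    c'' (e.trans e' i) = c i := (h' (e i)).trans (h i)

theorem colour_congrLeft {J : I' → Type} (e : I ≃ I') (d : ∀ i, J i → C) (x : Σ i, J (e i)) :
    d (Equiv.sigmaCongrLeft e x).1 (Equiv.sigmaCongrLeft e x).2 = d (e x.1) x.2 := rfl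

theorem colour_congrRight {J' : I → Type} (e : ∀ i, J i ≃ J' i) {d : ∀ i, J i → C}
    {d' : ∀ i, J' i → C} (h : ∀ i j, d' i (e i j) = d i j) (x : Σ i, J i) :
    d' (Equiv.sigmaCongrRight e x).1 (Equiv.sigmaCongrRight e x).2 = d x.1 x.2 := h x.1 x.2

theorem colour_unitSigma (c : I → C) (x : Σ _ : Unit, I) : c (unitSigmaEquiv I x) = c x.2 := rfl

theorem colour_sigmaUnit (c : I → C) (x : Σ _ : I, Unit) :
    c (Equiv.sigmaUnique I (fun _ => Unit) x) = c x.1 := rfl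

theorem colour_assoc {K : ∀ i, J i → Type} (b : ∀ i j, K i j → C)
    (x : Σ x : Σ i, J i, K x.1 x.2) :
    b (Equiv.sigmaAssoc K x).1 (Equiv.sigmaAssoc K x).2.1 (Equiv.sigmaAssoc K x).2.2 =
      b x.1.1 x.1.2 x.2 := rfl

theorem colour_fibre (f : I' → I) (c : I' → C) (x : Σ i, {j // f j = i}) :
    c (Equiv.sigmaFiberEquiv f x) = c x.2.1 := rfl

theorem colour_fibreId (i : I) (c : I → C) (x : Unit) : c (fibreIdEquiv i x).1 = c i := rfl

theorem colour_fibreComp {K J I : Type} (g : K → J) (f : J → I) (i : I) (c : K → C)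
    (x : Σ j : {j : J // f j = i}, {k : K // g k = j.1}) :
    c (fibreCompEquiv g f i x).1 = c x.2.1 := rfl

end Colours

/-- A symmetric operad in sets with set of colours `C`. `Op c c₀` is the set of operations with
inputs indexed by the finite set `I`, input colours `c i` and output colour `c₀`. The operation
`map` relabels inputs along a bijection that preserves colours (the proofs `h`, `h₀` say that the
colours agree, so for `e = Equiv.refl I` this is the identity), and `comp p q` substitutes the
operation `q i` into the `i`-th input of `p`, for all `i`. -/
structure SetOperad (C : Type u) where
  Op : ∀ {I : Type} [Finite I], (I → C) → C → Type u
  map : ∀ {I I' : Type} [Finite I] [Finite I'] {c : I → C} {c' : I' → C} {c₀ c₀' : C}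
    (e : I ≃ I') (_ : ∀ i, c' (e i) = c i) (_ : c₀ = c₀'), Op c c₀ → Op c' c₀'
  one : ∀ c₀ : C, Op (fun _ : Unit => c₀) c₀
  comp : ∀ {I : Type} {J : I → Type} [Finite I] [∀ i, Finite (J i)] {c : I → C}
    {d : ∀ i, J i → C} {c₀ : C} (_ : Op c c₀) (_ : ∀ i, Op (d i) (c i)),
    Op (fun x : Σ i, J i => d x.1 x.2) c₀
  map_refl : ∀ {I : Type} [Finite I] {c : I → C} {c₀ : C} (p : Op c c₀),
    map (Equiv.refl I) (colour_refl c) rfl p = p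
  map_map : ∀ {I I' I'' : Type} [Finite I] [Finite I'] [Finite I'']
    {c : I → C} {c' : I' → C} {c'' : I'' → C} {c₀ c₀' c₀'' : C}
    (e : I ≃ I') (h : ∀ i, c' (e i) = c i) (h₀ : c₀ = c₀')
    (e' : I' ≃ I'') (h' : ∀ i, c'' (e' i) = c' i) (h₀' : c₀' = c₀'') (p : Op c c₀),
    map e' h' h₀' (map e h h₀ p) =
      map (e.trans e') (colour_trans h h') (h₀.trans h₀') p
  comp_map_left : ∀ {I I' : Type} {J : I' → Type} [Finite I] [Finite I'] [∀ i, Finite (J i)]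
    {c : I → C} {c' : I' → C} {d : ∀ i, J i → C} {c₀ c₀' : C}
    (e : I ≃ I') (h : ∀ i, c' (e i) = c i) (h₀ : c₀ = c₀')
    (p : Op c c₀) (q : ∀ i, Op (d i) (c' i)),
    comp (map e h h₀ p) q =
      map (c' := fun x : Σ i, J i => d x.1 x.2) (Equiv.sigmaCongrLeft e) (colour_congrLeft e d) h₀
        (comp p (fun i => map (Equiv.refl (J (e i))) (colour_refl (d (e i))) (h i) (q (e i))))
  comp_map_right : ∀ {I : Type} {J J' : I → Type} [Finite I] [∀ i, Finite (J i)]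
    [∀ i, Finite (J' i)] {c : I → C} {d : ∀ i, J i → C} {d' : ∀ i, J' i → C} {c₀ : C}
    (e : ∀ i, J i ≃ J' i) (h : ∀ i j, d' i (e i j) = d i j)
    (p : Op c c₀) (q : ∀ i, Op (d i) (c i)),
    comp p (fun i => map (e i) (h i) rfl (q i)) =
      map (c' := fun x : Σ i, J' i => d' x.1 x.2) (Equiv.sigmaCongrRight e)
        (colour_congrRight e h) rfl (comp p q)
  one_comp : ∀ {I : Type} [Finite I] {c : I → C} {c₀ : C} (p : Op c c₀),
    map (unitSigmaEquiv I) (colour_unitSigma c) rfl (comp (one c₀) (fun _ => p)) = p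
  comp_one : ∀ {I : Type} [Finite I] {c : I → C} {c₀ : C} (p : Op c c₀),
    map (Equiv.sigmaUnique I (fun _ => Unit)) (colour_sigmaUnit c) rfl
      (comp p (fun i => one (c i))) = p
  comp_assoc : ∀ {I : Type} {J : I → Type} {K : ∀ i, J i → Type} [Finite I]
    [∀ i, Finite (J i)] [∀ i j, Finite (K i j)] {c : I → C} {d : ∀ i, J i → C}
    {b : ∀ i j, K i j → C} {c₀ : C}
    (p : Op c c₀) (q : ∀ i, Op (d i) (c i)) (r : ∀ i j, Op (b i j) (d i j)),
    map (c' := fun x : Σ i, Σ j, K i j => b x.1 x.2.1 x.2.2)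
        (Equiv.sigmaAssoc K) (colour_assoc b) rfl
        (comp (comp p q) (fun x : Σ i, J i => r x.1 x.2)) =
      comp p (fun i => comp (q i) (r i))

namespace SetOperad

variable {C : Type u}

/-- The suboperad `nuP` of the operations of `P` of non-zero arity. -/
def nu (P : SetOperad C) : SetOperad C where
  Op {I} _ c c₀ := {_p : P.Op c c₀ // Nonempty I}
  map e h h₀ p := ⟨P.map e h h₀ p.1, p.2.map e⟩
  one c₀ := ⟨P.one c₀, ⟨()⟩⟩
  comp p q := ⟨P.comp p.1 (fun i => (q i).1), p.2.elim fun i => (q i).2.map (Sigma.mk i)⟩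
  map_refl _ := Subtype.ext (P.map_refl _)
  map_map _ _ _ _ _ _ _ := Subtype.ext (P.map_map _ _ _ _ _ _ _)
  comp_map_left _ _ _ _ _ := Subtype.ext (P.comp_map_left _ _ _ _ _)
  comp_map_right _ _ _ _ := Subtype.ext (P.comp_map_right _ _ _ _)
  one_comp _ := Subtype.ext (P.one_comp _)
  comp_one _ := Subtype.ext (P.comp_one _)
  comp_assoc p q r := Subtype.ext
    (P.comp_assoc p.1 (fun i => (q i).1) (fun i j => (r i j).1))

theorem map_congr (P : SetOperad C) {I I' : Type} [Finite I] [Finite I'] {c : I → C}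
    {c' : I' → C} {c₀ c₀' : C} {e e' : I ≃ I'} (he : ∀ i, e i = e' i)
    (h : ∀ i, c' (e i) = c i) (h' : ∀ i, c' (e' i) = c i) (h₀ : c₀ = c₀') (p : P.Op c c₀) :
    P.map e h h₀ p = P.map e' h' h₀ p := by
  obtain rfl : e = e' := Equiv.ext he
  rfl

theorem comp_map_left' (P : SetOperad C) {I I' : Type} {J : I' → Type} [Finite I] [Finite I']
    [∀ i, Finite (J i)] {c : I → C} {c' : I' → C} {d : ∀ i, J i → C} {c₀ c₀' : C}
    (e : I ≃ I') (h : ∀ i, c' (e i) = c i) (h₀ : c₀ = c₀')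
    (p : P.Op c c₀) (q : ∀ i, P.Op (d i) (c' i)) (q' : ∀ i, P.Op (d (e i)) (c i))
    (hq : ∀ i, P.map (Equiv.refl (J (e i))) (colour_refl (d (e i))) (h i) (q (e i)) = q' i) :
    P.comp (P.map e h h₀ p) q =
      P.map (c' := fun x : Σ i, J i => d x.1 x.2) (Equiv.sigmaCongrLeft e)
        (colour_congrLeft e d) h₀ (P.comp p q') := by
  obtain rfl : _ = q' := funext hq
  exact P.comp_map_left e h h₀ p q

section Fibres

variable (P : SetOperad C) {L K J I : Type} [Finite L] [Finite K] [Finite J]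

theorem comp_fibre_one (f : J → I) (i : I) (c : J → C) {c₀ : C}
    (p : P.Op (fun j : {j // f j = i} => c j.1) c₀) :
    P.map (fibreCompEquiv (fun j => j) f i) (colour_fibreComp (fun j => j) f i c) rfl
      (P.comp p fun j => P.map (c' := fun k => c k.1) (fibreIdEquiv j.1) (colour_fibreId j.1 c) rfl
        (P.one (c j.1))) =
      p := by
  rw [P.comp_map_right (fun j : {j // f j = i} => fibreIdEquiv j.1)
    (fun j => colour_fibreId j.1 c) p (fun j => P.one (c j.1)), P.map_map]
  conv_rhs => rw [← P.comp_one p]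
  exact P.map_congr (fun _ => rfl) _ _ _ _

theorem one_comp_fibre (f : J → I) (c : J → C) (b : I → C)
    (p : ∀ i, P.Op (fun j : {j // f j = i} => c j.1) (b i)) (i : I) :
    P.map (fibreCompEquiv f (fun j => j) i) (colour_fibreComp f (fun j => j) i c) rfl
      (P.comp (P.map (c' := fun k => b k.1) (fibreIdEquiv i) (colour_fibreId i b) rfl
        (P.one (b i)))
        fun j => p j.1) = p i := by
  rw [P.comp_map_left' (c' := fun k => b k.1)
    (d := fun (k : {k : I // k = i}) (j : {j // f j = k.1}) => c j.1)
    (fibreIdEquiv i) (colour_fibreId i b) rfl (P.one (b i)) (fun j => p j.1)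
    (fun _ => p i) (fun _ => P.map_refl _), P.map_map]
  refine Eq.trans ?_ (P.one_comp (c := fun j : {j // f j = i} => c j.1) (p i))
  exact P.map_congr (I := Σ _ : Unit, {j // f j = i}) (I' := {j // f j = i})
    (c := fun x => c x.2.1) (c' := fun x => c x.1)
    (e := (Equiv.sigmaCongrLeft (fibreIdEquiv i)).trans (fibreCompEquiv f (fun j => j) i))
    (e' := unitSigmaEquiv _) (fun _ => rfl) _ _ _ _

theorem comp_fibre_assoc (h : L → K) (g : K → J) (f : J → I) (i : I) (a : L → C) (b : K → C)
    (c : J → C) {c₀ : C} (p : P.Op (fun j : {j // f j = i} => c j.1) c₀)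
    (q : ∀ j, P.Op (fun k : {k // g k = j} => b k.1) (c j))
    (r : ∀ k, P.Op (fun l : {l // h l = k} => a l.1) (b k)) :
    P.map (c' := fun l => a l.1) (fibreCompEquiv (fun l => g (h l)) f i)
        (colour_fibreComp (fun l => g (h l)) f i a) rfl
        (P.comp p fun j => P.map (c' := fun l => a l.1) (fibreCompEquiv h g j.1)
          (colour_fibreComp h g j.1 a) rfl
          (P.comp (q j.1) fun k => r k.1)) =
      P.map (c' := fun l => a l.1) (fibreCompEquiv h (fun k => f (g k)) i)
        (colour_fibreComp h (fun k => f (g k)) i a) rfl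
        (P.comp (P.map (c' := fun k => b k.1) (fibreCompEquiv g f i) (colour_fibreComp g f i b) rfl
          (P.comp p fun j => q j.1)) fun k => r k.1) := by
  rw [P.comp_map_right (fun j : {j // f j = i} => fibreCompEquiv h g j.1)
    (fun j => colour_fibreComp h g j.1 a) p (fun j => P.comp (q j.1) (fun k => r k.1)),
    ← P.comp_assoc]
  rw [P.comp_map_left' (fibreCompEquiv g f i) (colour_fibreComp g f i b) rfl
    (P.comp p fun j => q j.1) (fun k => r k.1) (fun x => r x.2.1) (fun _ => P.map_refl _),
    P.map_map, P.map_map, P.map_map]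
  exact P.map_congr (fun _ => rfl) _ _ _ _

end Fibres

/-! ### The category `C(P)` -/

/-- Objects of `C(P)`: operations of `P`, with their inputs numbered. -/
structure Operation (P : SetOperad C) : Type u where
  arity : ℕ
  inColour : Fin arity → C
  outColour : C
  op : P.Op inColour outColour

variable {P : SetOperad C}

/-- Morphisms `q ⟶ p` of `C(P)`: 2-level trees with lowest vertex marked by `p`. The map `index`
sends the index of a leaf to the number of the upper vertex below this leaf, so that the leaves
above the `i`-th upper vertex are indexed by the fibre of `index` over `i`; since these indices
increase in planar order, the operation marking the `i`-th upper vertex is the same as an operation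
`upper i` whose inputs are indexed by this fibre. The last field says that `q` is the composition
of `p` with the operations `upper i`, with inputs indexed according to the indices of leaves. -/
@[ext]
structure TwoLevelTree (q p : Operation P) : Type u where
  index : Fin q.arity → Fin p.arity
  upper : ∀ i : Fin p.arity,
    P.Op (fun j : {j : Fin q.arity // index j = i} => q.inColour j.1) (p.inColour i)
  out_eq : p.outColour = q.outColour
  comp_eq : P.map (Equiv.sigmaFiberEquiv index) (colour_fibre index q.inColour) out_eq
    (P.comp p.op upper) = q.op

namespace TwoLevelTree

/-- The identity 2-level tree: all upper vertices are marked by identity operations. -/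
def id (p : Operation P) : TwoLevelTree p p where
  index i := i
  upper i := P.map (fibreIdEquiv i) (colour_fibreId i p.inColour) rfl (P.one (p.inColour i))
  out_eq := rfl
  comp_eq := by
    rw [P.comp_map_right (fun i => fibreIdEquiv i) (fun i => colour_fibreId i p.inColour) p.op
      (fun i => P.one (p.inColour i)), P.map_map]
    exact P.comp_one p.op

/-- The composition of 2-level trees `g : r ⟶ q` and `f : q ⟶ p`: the upper vertices of `g` are
grafted into the leaves of `f`, and the subtrees above the lowest vertex are composed. -/
def comp {r q p : Operation P} (g : TwoLevelTree r q) (f : TwoLevelTree q p) :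
    TwoLevelTree r p where
  index k := f.index (g.index k)
  upper i := P.map (fibreCompEquiv g.index f.index i)
    (colour_fibreComp g.index f.index i r.inColour) rfl
    (P.comp (f.upper i) (fun j => g.upper j.1))
  out_eq := f.out_eq.trans g.out_eq
  comp_eq := by
    rw [P.comp_map_right (fun i => fibreCompEquiv g.index f.index i)
      (fun i => colour_fibreComp g.index f.index i r.inColour) p.op
      (fun i => P.comp (f.upper i) (fun j => g.upper j.1)), ← P.comp_assoc, P.map_map, P.map_map]
    conv_rhs => rw [← g.comp_eq, ← f.comp_eq, P.comp_map_left, P.map_map]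
    have : ∀ x : Σ i, {j // f.index j = i}, P.map (Equiv.refl _) (colour_refl _)
        (colour_fibre f.index q.inColour x) (g.upper (Equiv.sigmaFiberEquiv f.index x)) =
        g.upper x.2.1 := fun x => P.map_refl _
    simp only [this]
    exact P.map_congr (fun _ => rfl) _ _ _ _

protected theorem id_comp {q p : Operation P} (f : TwoLevelTree q p) : (id q).comp f = f :=
  TwoLevelTree.ext rfl (heq_of_eq (funext fun i =>
    P.comp_fibre_one f.index i q.inColour (f.upper i)))

protected theorem comp_id {q p : Operation P} (f : TwoLevelTree q p) : f.comp (id p) = f :=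
  TwoLevelTree.ext rfl (heq_of_eq (funext fun i =>
    P.one_comp_fibre f.index q.inColour p.inColour f.upper i))

protected theorem assoc {s r q p : Operation P} (h : TwoLevelTree s r) (g : TwoLevelTree r q)
    (f : TwoLevelTree q p) : (h.comp g).comp f = h.comp (g.comp f) :=
  TwoLevelTree.ext rfl (heq_of_eq (funext fun i =>
    P.comp_fibre_assoc h.index g.index f.index i s.inColour r.inColour q.inColour
      (f.upper i) g.upper h.upper))

end TwoLevelTree

/-- The category `C(P)` of an operad `P`. -/
instance : SmallCategory (Operation P) where
  Hom := TwoLevelTree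
  id := TwoLevelTree.id
  comp := TwoLevelTree.comp
  id_comp := TwoLevelTree.id_comp
  comp_id := TwoLevelTree.comp_id
  assoc := TwoLevelTree.assoc

end SetOperad

/-! ### The operad `sOp` of symmetric operads -/

/-- Planar rooted trees with half-edges: the vertices carry labels from `I`, where a vertex labelled
by `i` has `c i` linearly ordered input half-edges, and the (input) leaves carry labels from `L`.
`leaf l` is the tree without vertices, and `node i t` has a root vertex with label `i`, with the
trees `t k` attached to its inputs. -/
inductive PlanarTree {I : Type} (c : I → ℕ) (L : Type) : Type
  | leaf (l : L) : PlanarTree c L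
  | node (i : I) (t : Fin (c i) → PlanarTree c L) : PlanarTree c L

namespace PlanarTree

variable {I I' I'' : Type} {c : I → ℕ} {c' : I' → ℕ} {c'' : I'' → ℕ} {L L' L'' : Type}

open Classical in
/-- The number of vertices labelled by `i`. -/
noncomputable def vertexCount (i : I) : PlanarTree c L → ℕ
  | leaf _ => 0
  | node j t => (if j = i then 1 else 0) + ∑ k, vertexCount i (t k)

open Classical in
/-- The number of leaves labelled by `l`. -/
noncomputable def leafCount (l : L) : PlanarTree c L → ℕ
  | leaf l' => if l' = l then 1 else 0
  | node _ t => ∑ k, leafCount l (t k)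

/-- The labellings of vertices and of leaves are bijections. -/
def IsOperadic (t : PlanarTree c L) : Prop :=
  (∀ i, vertexCount i t = 1) ∧ ∀ l, leafCount l t = 1

/-- Change of labels of vertices and leaves. -/
def relabel (e : I → I') (h : ∀ i, c' (e i) = c i) (g : L → L') :
    PlanarTree c L → PlanarTree c' L'
  | leaf l => leaf (g l)
  | node i t => node (e i) fun k => relabel e h g (t (Fin.cast (h i) k))

/-- Grafting of the trees `s l` into the leaves of a tree. -/
def graft (s : L → PlanarTree c L') : PlanarTree c L → PlanarTree c L'
  | leaf l => s l
  | node i t => node i fun k => graft s (t k)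

/-- Substitution of trees `q i`, with leaves labelled by the inputs of the vertices labelled
by `i`, into the vertices of a tree. -/
def subst {J : I → Type} {d : ∀ i, J i → ℕ} (q : ∀ i, PlanarTree (d i) (Fin (c i))) :
    PlanarTree c L → PlanarTree (fun x : Σ i, J i => d x.1 x.2) L
  | leaf l => leaf l
  | node i t => graft (fun k => subst q (t k))
      (relabel (c' := fun x : Σ i, J i => d x.1 x.2) (Sigma.mk i) (fun _ => rfl) id (q i))

theorem relabel_refl (t : PlanarTree c L) :
    relabel (c' := c) (fun i => i) (fun _ => rfl) (fun l => l) t = t := by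
  induction t with
  | leaf l => rfl
  | node i t ih => exact congrArg _ (funext fun k => ih k)

theorem relabel_relabel (e : I → I') (h : ∀ i, c' (e i) = c i) (g : L → L') (e' : I' → I'')
    (h' : ∀ i, c'' (e' i) = c' i) (g' : L' → L'') (h'' : ∀ i, c'' (e' (e i)) = c i)
    (t : PlanarTree c L) :
    relabel e' h' g' (relabel e h g t) = relabel (fun i => e' (e i)) h'' (fun l => g' (g l)) t := by
  induction t with
  | leaf l => rfl
  | node i t ih => exact congrArg _ (funext fun k => ih _)

theorem relabel_graft (e : I → I') (h : ∀ i, c' (e i) = c i) (g : L' → L'')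
    (s : L → PlanarTree c L') (t : PlanarTree c L) :
    relabel e h g (graft s t) = graft (fun l => relabel e h g (s l))
      (relabel e h (fun l => l) t) := by
  induction t with
  | leaf l => rfl
  | node i t ih => exact congrArg _ (funext fun k => ih _)

theorem graft_relabel (e : I → I') (h : ∀ i, c' (e i) = c i) (g : L → L')
    (s : L' → PlanarTree c' L'') (t : PlanarTree c L) :
    graft s (relabel e h g t) = graft (fun l => s (g l)) (relabel e h (fun l => l) t) := by
  induction t with
  | leaf l => rfl
  | node i t ih => exact congrArg _ (funext fun k => ih _)

theorem graft_graft (s : L → PlanarTree c L') (s' : L' → PlanarTree c L'') (t : PlanarTree c L) :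
    graft s' (graft s t) = graft (fun l => graft s' (s l)) t := by
  induction t with
  | leaf l => rfl
  | node i t ih => exact congrArg _ (funext fun k => ih _)

theorem graft_leaf (t : PlanarTree c L) : graft leaf t = t := by
  induction t with
  | leaf l => rfl
  | node i t ih => exact congrArg _ (funext fun k => ih _)

section Subst

variable {J J' : I → Type} {d : ∀ i, J i → ℕ} {d' : ∀ i, J' i → ℕ}

theorem subst_graft (q : ∀ i, PlanarTree (d i) (Fin (c i))) (s : L → PlanarTree c L')
    (t : PlanarTree c L) :
    subst q (graft s t) = graft (fun l => subst q (s l)) (subst q t) := by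
  induction t with
  | leaf l => rfl
  | node i t ih =>
    simp only [graft, subst, graft_graft]
    congr 1
    exact funext ih

theorem subst_relabel {J : I' → Type} {d : ∀ i, J i → ℕ} (e : I → I')
    (h : ∀ i, c' (e i) = c i) (g : L → L') (q : ∀ i, PlanarTree (d i) (Fin (c' i)))
    (t : PlanarTree c L) :
    subst q (relabel e h g t) =
      relabel (c := fun x : Σ i, J (e i) => d (e x.1) x.2) (c' := fun x : Σ i, J i => d x.1 x.2)
        (fun x => ⟨e x.1, x.2⟩) (fun _ => rfl) g
        (subst (fun i => relabel (c' := d (e i)) (fun j => j) (fun _ => rfl) (Fin.cast (h i))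
          (q (e i))) t) := by
  induction t with
  | leaf l => rfl
  | node i t ih =>
    simp only [relabel, subst, relabel_graft, ih]
    rw [relabel_relabel (h'' := fun _ => rfl), relabel_relabel (h'' := fun _ => rfl)]
    conv_rhs => rw [graft_relabel]
    conv_lhs => rw [graft_relabel]
    rfl

theorem subst_relabel_right (e : ∀ i, J i → J' i) (h : ∀ i j, d' i (e i j) = d i j)
    (q : ∀ i, PlanarTree (d i) (Fin (c i))) (t : PlanarTree c L) :
    subst (fun i => relabel (e i) (h i) (fun k => k) (q i)) t =
      relabel (c := fun x : Σ i, J i => d x.1 x.2) (c' := fun x : Σ i, J' i => d' x.1 x.2)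
        (fun x => ⟨x.1, e x.1 x.2⟩) (fun x => h x.1 x.2) (fun l => l) (subst q t) := by
  induction t with
  | leaf l => rfl
  | node i t ih =>
    simp only [subst, relabel_graft, ih]
    exact congrArg _ ((relabel_relabel (c'' := fun x : Σ i, J' i => d' x.1 x.2) (e i) (h i)
      (fun k => k) (Sigma.mk i) (fun _ => rfl) id (h i) (q i)).trans
      (relabel_relabel (c' := fun x : Σ i, J i => d x.1 x.2)
        (c'' := fun x : Σ i, J' i => d' x.1 x.2) (Sigma.mk i) (fun _ => rfl) id
        (fun x => ⟨x.1, e x.1 x.2⟩) (fun x => h x.1 x.2) (fun l => l) (h i) (q i)).symm)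

theorem subst_subst {K : ∀ i, J i → Type} {b : ∀ i j, K i j → ℕ}
    (q : ∀ i, PlanarTree (d i) (Fin (c i))) (r : ∀ i j, PlanarTree (b i j) (Fin (d i j)))
    (t : PlanarTree c L) :
    relabel (c := fun x : Σ x : Σ i, J i, K x.1 x.2 => b x.1.1 x.1.2 x.2)
        (c' := fun x : Σ i, Σ j, K i j => b x.1 x.2.1 x.2.2)
        (fun x => ⟨x.1.1, x.1.2, x.2⟩) (fun _ => rfl) (fun l => l)
        (subst (fun x : Σ i, J i => r x.1 x.2) (subst q t)) =
      subst (fun i => subst (r i) (q i)) t := by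
  induction t with
  | leaf l => rfl
  | node i t ih =>
    simp only [subst, subst_graft, relabel_graft, ih]
    rw [subst_relabel, relabel_relabel (h'' := fun _ => rfl)]
    congr 1
    exact congrArg (fun r' => relabel (c := fun x : Σ j, K i j => b i x.1 x.2)
      (c' := fun x : Σ i, Σ j, K i j => b x.1 x.2.1 x.2.2) (fun x => ⟨i, x⟩) (fun _ => rfl) id
      (subst r' (q i))) (funext fun j => relabel_refl (r i j))

theorem corolla_subst (n : ℕ) (t : PlanarTree c (Fin n)) :
    relabel (c := fun x : Σ _ : Unit, I => c x.2) (c' := c) (fun x => x.2) (fun _ => rfl)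
      (fun l => l) (subst (fun _ => t) (node (c := fun _ : Unit => n) () leaf)) = t := by
  simp only [subst, graft_leaf]
  exact (relabel_relabel (c' := fun x : Σ _ : Unit, I => c x.2) (c'' := c) (Sigma.mk ())
    (fun _ => rfl) id (fun x => x.2) (fun _ => rfl) (fun l => l) (fun _ => rfl) t).trans
    (relabel_refl t)

theorem subst_corolla (t : PlanarTree c L) :
    relabel (c := fun x : Σ _ : I, Unit => c x.1) (c' := c) (fun x => x.1) (fun _ => rfl)
      (fun l => l) (subst (fun i => node (c := fun _ : Unit => c i) () leaf) t) = t := by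
  induction t with
  | leaf l => rfl
  | node i t ih =>
    simp only [subst, relabel_graft]
    exact congrArg _ (funext fun k => ih k)

end Subst

section Count

theorem vertexCount_graft (i : I) (s : L → PlanarTree c L') [Fintype L] (t : PlanarTree c L) :
    vertexCount i (graft s t) = vertexCount i t + ∑ l, leafCount l t * vertexCount i (s l) := by
  induction t with
  | leaf l =>
    simp only [graft, vertexCount, leafCount, zero_add]
    rw [Finset.sum_eq_single l] <;> simp +contextual [eq_comm]
  | node j t ih =>
    simp only [graft, vertexCount, leafCount, ih, Finset.sum_add_distrib, Finset.sum_mul, add_assoc]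
    rw [Finset.sum_comm]

theorem leafCount_graft (l' : L') (s : L → PlanarTree c L') [Fintype L] (t : PlanarTree c L) :
    leafCount l' (graft s t) = ∑ l, leafCount l t * leafCount l' (s l) := by
  induction t with
  | leaf l =>
    simp only [graft, leafCount]
    rw [Finset.sum_eq_single l] <;> simp +contextual [eq_comm]
  | node j t ih =>
    simp only [graft, leafCount, ih, Finset.sum_mul]
    rw [Finset.sum_comm]

theorem vertexCount_relabel (e : I → I') (he : e.Injective) (h : ∀ i, c' (e i) = c i) (g : L → L')
    (i : I) (t : PlanarTree c L) : vertexCount (e i) (relabel e h g t) = vertexCount i t := by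
  induction t with
  | leaf l => rfl
  | node j t ih =>
    simp only [relabel, vertexCount, ih]
    refine congrArg₂ _ (by by_cases hj : j = i <;> simp [he.eq_iff, hj]) ?_
    exact Fintype.sum_equiv (finCongr (h j)) _ _ fun _ => rfl

theorem vertexCount_relabel_of_ne (e : I → I') (h : ∀ i, c' (e i) = c i) (g : L → L')
    (i' : I') (hi : ∀ i, e i ≠ i') (t : PlanarTree c L) :
    vertexCount i' (relabel e h g t) = 0 := by
  induction t with
  | leaf l => rfl
  | node j t ih => simp [relabel, vertexCount, ih, hi]

theorem leafCount_relabel (e : I → I') (h : ∀ i, c' (e i) = c i) (g : L → L') (hg : g.Injective)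
    (l : L) (t : PlanarTree c L) : leafCount (g l) (relabel e h g t) = leafCount l t := by
  induction t with
  | leaf l' => by_cases hl : l' = l <;> simp [relabel, leafCount, hg.eq_iff, hl]
  | node j t ih =>
    simp only [relabel, leafCount, ih]
    exact Fintype.sum_equiv (finCongr (h j)) _ _ fun _ => rfl

variable {J : I → Type} {d : ∀ i, J i → ℕ}

theorem leafCount_subst (q : ∀ i, PlanarTree (d i) (Fin (c i))) (hq : ∀ i, (q i).IsOperadic)
    (l : L) (t : PlanarTree c L) : leafCount l (subst q t) = leafCount l t := by
  induction t with
  | leaf l => rfl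
  | node i t ih =>
    simp only [subst, leafCount_graft, leafCount, ih]
    refine Finset.sum_congr rfl fun k _ => ?_
    have := leafCount_relabel (c' := fun x : Σ i, J i => d x.1 x.2) (Sigma.mk i) (fun _ => rfl)
      id Function.injective_id k (q i)
    rw [id, (hq i).2 k] at this
    rw [this, one_mul]

theorem vertexCount_subst (q : ∀ i, PlanarTree (d i) (Fin (c i))) (hq : ∀ i, (q i).IsOperadic)
    (i : I) (j : J i) (t : PlanarTree c L) :
    vertexCount ⟨i, j⟩ (subst q t) = vertexCount i t := by
  induction t with
  | leaf l => rfl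
  | node i' t ih =>
    simp only [subst, vertexCount_graft, vertexCount, ih]
    congr 1
    · split_ifs with hi
      · subst hi
        rw [vertexCount_relabel (Sigma.mk i') sigma_mk_injective, (hq i').1]
      · exact vertexCount_relabel_of_ne _ _ _ _ (fun j' hj => hi (congrArg Sigma.fst hj)) _
    · refine Finset.sum_congr rfl fun k _ => ?_
      have := leafCount_relabel (c' := fun x : Σ i, J i => d x.1 x.2) (Sigma.mk i')
        (fun _ => rfl) id Function.injective_id k (q i')
      rw [id, (hq i').2 k] at this
      rw [this, one_mul]

theorem IsOperadic.subst {q : ∀ i, PlanarTree (d i) (Fin (c i))} (hq : ∀ i, (q i).IsOperadic)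
    {t : PlanarTree c L} (ht : t.IsOperadic) : (t.subst q).IsOperadic :=
  ⟨fun x => (vertexCount_subst q hq x.1 x.2 t).trans (ht.1 _),
    fun l => (leafCount_subst q hq l t).trans (ht.2 l)⟩

theorem IsOperadic.relabel {t : PlanarTree c L} (ht : t.IsOperadic) (e : I ≃ I')
    (h : ∀ i, c' (e i) = c i) (g : L ≃ L') : (t.relabel e h g).IsOperadic := by
  constructor
  · intro i
    obtain ⟨i, rfl⟩ := e.surjective i
    exact (vertexCount_relabel e e.injective h g i t).trans (ht.1 i)
  · intro l
    obtain ⟨l, rfl⟩ := g.surjective l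
    exact (leafCount_relabel e h g g.injective l t).trans (ht.2 l)

theorem isOperadic_corolla (n : ℕ) :
    (node (c := fun _ : Unit => n) () leaf).IsOperadic :=
  ⟨fun _ => by simp [vertexCount], fun l => by
    simp only [leafCount]
    rw [Finset.sum_eq_single l] <;> simp +contextual⟩

end Count

end PlanarTree

/-- The operad `sOp` with set of colours `ℕ`, whose algebras are the (one-coloured) symmetric
operads. The operations with inputs indexed by `I`, input colours `c i` and output colour `m` are
the operadic trees: planar rooted trees with half-edges, with vertices indexed bijectively by `I`,
with the vertex indexed by `i` having `c i` input edges, and with `m` input leaves indexed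
bijectively (and not necessarily in planar order) by `Fin m`. Operadic composition is substitution
of trees into vertices, and identities are corollas with leaves indexed in planar order. -/
noncomputable def sOp : SetOperad ℕ where
  Op {_} _ c m := {t : PlanarTree c (Fin m) // t.IsOperadic}
  map e h h₀ t := ⟨t.1.relabel e h (Fin.cast h₀), t.2.relabel e h (finCongr h₀)⟩
  one n := ⟨.node () .leaf, PlanarTree.isOperadic_corolla n⟩
  comp p q := ⟨p.1.subst fun i => (q i).1, p.2.subst fun i => (q i).2⟩
  map_refl p := Subtype.ext (PlanarTree.relabel_refl p.1)
  map_map _ _ _ _ _ _ p := Subtype.ext (PlanarTree.relabel_relabel _ _ _ _ _ _ _ p.1)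
  comp_map_left e h h₀ p q := Subtype.ext
    (PlanarTree.subst_relabel e h (Fin.cast h₀) (fun i => (q i).1) p.1)
  comp_map_right e h p q := Subtype.ext
    (PlanarTree.subst_relabel_right (fun i => e i) h (fun i => (q i).1) p.1)
  one_comp p := Subtype.ext (PlanarTree.corolla_subst _ p.1)
  comp_one p := Subtype.ext (PlanarTree.subst_corolla p.1)
  comp_assoc p q r := Subtype.ext
    (PlanarTree.subst_subst (fun i => (q i).1) (fun i j => (r i j).1) p.1)

/-! A morphism `q ⟶ p` amounts to a family of trees, one for each vertex of `p`, each with at least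
one vertex, whose substitution into `p` gives `q`. It is planar if the leaves of all these trees are
labelled in planar order. Planar morphisms compose (`leaves_plug`), and the required functor is the
inclusion of the opposite of the category they form. It is surjective on objects. Property (F) holds
because every morphism becomes planar once the inputs of the vertices of `p` are permuted, which can
be done in finitely many ways (`exists_planar_comp_permuteHom_eq`).

(G1): a planar `f : q ⟶ p` is encoded by the word that lists, along the preorder of `q`, the vertex
of `p` to which each vertex of `q` belongs. The word marks the regions of `q` filled by the inserted
trees, and planarity fixes their leaf labels, so the word determines `f` (`eq_of_plug_eq_plug`).
Words are compared lexicographically. Precomposing with a planar `r ⟶ q` only inserts letters of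
vertices of `q` already met (`insertSeen_plug`), so the first difference between two words survives
(`map_lt_map`).

(G2): Kruskal's tree theorem, with leaf labels in a finite set (`wellQuasiOrdered_emb`), is applied
simultaneously to the finitely many upper trees. If the two trees of an embedding have equally many
leaves, the branches missed by it are leafless. They and the skipped vertices can be absorbed into
trees substituted for the vertices of the smaller tree (`exists_plug_eq`), which yields a planar
factorization (`exists_planar_comp_eq`).

Non-zero arity matters twice: inserted trees have a vertex, so no letter of a word is lost, and the
smaller tree has a root vertex to absorb what lies below it. -/

namespace PlanarTree

/-! ### Preorder lists of vertices and leaves. -/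

section Lists

variable {I I' : Type} {c : I → ℕ} {c' : I' → ℕ} {L L' L'' : Type}

/-- The labels of the vertices of a planar tree, listed in preorder. -/
def vertices : PlanarTree c L → List I
  | leaf _ => []
  | node i t => i :: (List.ofFn fun k => vertices (t k)).flatten

/-- The labels of the leaves of a planar tree, listed in planar order. -/
def leaves : PlanarTree c L → List L
  | leaf l => [l]
  | node _ t => (List.ofFn fun k => leaves (t k)).flatten

theorem mem_vertices_node {x i : I} {t : Fin (c i) → PlanarTree c L} :
    x ∈ (node i t).vertices ↔ x = i ∨ ∃ k, x ∈ (t k).vertices := by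
  simp [vertices, List.mem_flatten, List.mem_ofFn]

theorem mem_leaves_node {l : L} {i : I} {t : Fin (c i) → PlanarTree c L} :
    l ∈ (node i t).leaves ↔ ∃ k, l ∈ (t k).leaves := by
  simp [leaves, List.mem_flatten, List.mem_ofFn]

theorem count_flatten_ofFn {α : Type*} [DecidableEq α] (a : α) {n : ℕ} (f : Fin n → List α) :
    (List.ofFn f).flatten.count a = ∑ k, (f k).count a := by
  rw [List.count_flatten, List.map_ofFn, List.sum_ofFn]
  rfl

theorem vertexCount_eq_count [DecidableEq I] (i : I) (t : PlanarTree c L) :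
    vertexCount i t = t.vertices.count i := by
  induction t with
  | leaf l => simp [vertexCount, vertices]
  | node j t ih =>
    simp only [vertexCount, vertices, List.count_cons, count_flatten_ofFn, ih, beq_iff_eq]
    rw [add_comm]
    congr

theorem leafCount_eq_count [DecidableEq L] (l : L) (t : PlanarTree c L) :
    leafCount l t = t.leaves.count l := by
  induction t with
  | leaf l' => by_cases h : l' = l <;> simp [leafCount, leaves, h]
  | node j t ih => simp only [leafCount, leaves, count_flatten_ofFn, ih]

theorem vertexCount_ne_zero {i : I} {t : PlanarTree c L} :
    vertexCount i t ≠ 0 ↔ i ∈ t.vertices := by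
  classical
  rw [vertexCount_eq_count, ← Nat.pos_iff_ne_zero, List.count_pos_iff]

theorem IsOperadic.nodup_vertices {t : PlanarTree c L} (ht : t.IsOperadic) :
    t.vertices.Nodup := by
  classical
  exact List.nodup_iff_count_le_one.2 fun i => by rw [← vertexCount_eq_count, ht.1 i]

theorem IsOperadic.mem_vertices {t : PlanarTree c L} (ht : t.IsOperadic) (i : I) :
    i ∈ t.vertices :=
  vertexCount_ne_zero.1 (by rw [ht.1 i]; exact one_ne_zero)

theorem IsOperadic.nodup_leaves {t : PlanarTree c L} (ht : t.IsOperadic) : t.leaves.Nodup := by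
  classical
  exact List.nodup_iff_count_le_one.2 fun i => by rw [← leafCount_eq_count, ht.2 i]

theorem IsOperadic.mem_leaves {t : PlanarTree c L} (ht : t.IsOperadic) (l : L) :
    l ∈ t.leaves := by
  classical
  exact List.count_pos_iff.1 (by rw [← leafCount_eq_count, ht.2 l]; exact one_pos)

theorem vertices_relabel (e : I → I') (h : ∀ i, c' (e i) = c i) (g : L → L')
    (t : PlanarTree c L) : (relabel e h g t).vertices = t.vertices.map e := by
  induction t with
  | leaf l => rfl
  | node i t ih =>
    simp only [relabel, vertices, ih, List.map_cons, List.map_flatten, List.map_ofFn]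
    rw [List.ofFn_congr (h i)]
    rfl

theorem leaves_relabel (e : I → I') (h : ∀ i, c' (e i) = c i) (g : L → L')
    (t : PlanarTree c L) : (relabel e h g t).leaves = t.leaves.map g := by
  induction t with
  | leaf l => rfl
  | node i t ih =>
    simp only [relabel, leaves, ih, List.map_flatten, List.map_ofFn]
    rw [List.ofFn_congr (h i)]
    rfl

theorem flatMap_flatten_ofFn {α β : Type*} {n : ℕ} (f : Fin n → List α) (g : α → List β) :
    (List.ofFn f).flatten.flatMap g = (List.ofFn fun k => (f k).flatMap g).flatten := by
  induction n with
  | zero => rfl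
  | succ n ih => simp [List.ofFn_succ, ih]

theorem leaves_graft (s : L → PlanarTree c L') (t : PlanarTree c L) :
    (graft s t).leaves = t.leaves.flatMap fun l => (s l).leaves := by
  induction t with
  | leaf l => simp [graft, leaves]
  | node i t ih => simp only [graft, leaves, ih, flatMap_flatten_ofFn]

theorem mem_vertices_graft {x : I} (s : L → PlanarTree c L') (t : PlanarTree c L) :
    x ∈ (graft s t).vertices ↔ x ∈ t.vertices ∨ ∃ l ∈ t.leaves, x ∈ (s l).vertices := by
  induction t with
  | leaf l => simp [graft, leaves, vertices]
  | node i t ih =>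
    simp only [graft, mem_vertices_node, mem_leaves_node, ih]
    grind

theorem leafCount_of_leaves_eq {n : ℕ} {t : PlanarTree c (Fin n)} (h : t.leaves = List.finRange n)
    (l : Fin n) : leafCount l t = 1 := by
  rw [leafCount_eq_count, h]
  exact List.count_eq_one_of_mem (List.nodup_finRange n) (List.mem_finRange l)

end Lists

/-! ### Substitution with a common set of vertex labels. -/

section Plug

variable {I I' I'' : Type} {c : I → ℕ} {c' : I' → ℕ} {c'' : I'' → ℕ} {L L' : Type}

/-- Substitution of trees with vertices labelled by a common set into the vertices of a tree. -/
def plug (u : ∀ i, PlanarTree c' (Fin (c i))) : PlanarTree c L → PlanarTree c' L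
  | leaf l => leaf l
  | node i t => graft (fun k => plug u (t k)) (u i)

theorem plug_congr {u u' : ∀ i, PlanarTree c' (Fin (c i))} {t : PlanarTree c L}
    (h : ∀ i ∈ t.vertices, u i = u' i) : plug u t = plug u' t := by
  induction t with
  | leaf l => rfl
  | node i t ih =>
    simp only [plug]
    rw [h i (mem_vertices_node.2 (Or.inl rfl)),
      funext fun k => ih k fun j hj => h j (mem_vertices_node.2 (Or.inr ⟨k, hj⟩))]

theorem plug_relabel_vertices (e : I'' → I) (u : ∀ i, PlanarTree c' (Fin (c i)))
    (t : PlanarTree (fun i => c (e i)) L) :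
    plug u (relabel (c' := c) e (fun _ => rfl) id t) = plug (fun i => u (e i)) t := by
  induction t with
  | leaf l => rfl
  | node i t ih => exact congrArg (fun s => graft s _) (funext fun k => ih k)

/-- Relabelling commutes with grafting, so the dependent vertex labels of operadic substitution can
be traded for labels in one fixed set. -/
theorem relabel_subst {J : I → Type} {d : ∀ i, J i → ℕ} (e : (Σ i, J i) → I')
    (h : ∀ x, c' (e x) = d x.1 x.2) (q : ∀ i, PlanarTree (d i) (Fin (c i)))
    (t : PlanarTree c L) :
    relabel (c := fun x : Σ i, J i => d x.1 x.2) e h id (subst q t) =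
      plug (fun i => relabel (fun j => e ⟨i, j⟩) (fun j => h ⟨i, j⟩) id (q i)) t := by
  induction t with
  | leaf l => rfl
  | node i t ih =>
    simp only [subst, plug, relabel_graft, ih]
    exact congrArg (graft _) (relabel_relabel (c' := fun x : Σ i, J i => d x.1 x.2)
      (c'' := c') (Sigma.mk i) (fun _ => rfl) id e h id (fun j => h ⟨i, j⟩) (q i))

/-- If the inserted trees are planar, the subtrees grafted on them keep their left-to-right order.
This is why planar morphisms compose. -/
theorem leaves_plug {u : ∀ i, PlanarTree c' (Fin (c i))}
    (hu : ∀ i, (u i).leaves = List.finRange (c i)) (t : PlanarTree c L) :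
    (plug u t).leaves = t.leaves := by
  induction t with
  | leaf l => rfl
  | node i t ih =>
    simp only [plug, leaves_graft, hu, ih, leaves, List.ofFn_eq_map, List.flatMap_def]

/-- Each leaf label of `u i` occurs exactly once, so no subtree is lost or duplicated by grafting.
-/
theorem vertexCount_plug [Fintype I] {u : ∀ i, PlanarTree c' (Fin (c i))}
    (hu : ∀ i k, leafCount k (u i) = 1) (x : I') (t : PlanarTree c L) :
    vertexCount x (plug u t) = ∑ i, vertexCount i t * vertexCount x (u i) := by
  classical
  induction t with
  | leaf l => simp [plug, vertexCount]
  | node i t ih =>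
    simp only [plug, vertexCount_graft, vertexCount, hu, one_mul, ih, add_mul,
      Finset.sum_add_distrib, Finset.sum_mul, ite_mul, zero_mul]
    rw [Finset.sum_comm]
    simp

theorem mem_vertices_plug {u : ∀ i, PlanarTree c' (Fin (c i))} {x : I'} {t : PlanarTree c L}
    (hx : x ∈ (plug u t).vertices) : ∃ i ∈ t.vertices, x ∈ (u i).vertices := by
  induction t with
  | leaf l => simp [plug, vertices] at hx
  | node i t ih =>
    obtain hx | ⟨k, -, hx⟩ := (mem_vertices_graft _ _).1 hx
    · exact ⟨i, mem_vertices_node.2 (Or.inl rfl), hx⟩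
    · obtain ⟨j, hj, hx⟩ := ih k hx
      exact ⟨j, mem_vertices_node.2 (Or.inr ⟨k, hj⟩), hx⟩

/-- A tree all of whose vertices have labels with property `p` comes from a tree with vertices
labelled by the subtype. -/
theorem exists_relabel_val_eq (p : I → Prop) (t : PlanarTree c L) (ht : ∀ i ∈ t.vertices, p i) :
    ∃ t' : PlanarTree (fun i : {i // p i} => c i.1) L,
      relabel (c' := c) Subtype.val (fun _ => rfl) id t' = t := by
  induction t with
  | leaf l => exact ⟨leaf l, rfl⟩
  | node i t ih =>
    choose t' ht' using fun k => ih k fun j hj => ht j (mem_vertices_node.2 (Or.inr ⟨k, hj⟩))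
    exact ⟨node ⟨i, ht i (mem_vertices_node.2 (Or.inl rfl))⟩ t',
      congrArg (node i) (funext fun k => ht' k)⟩

theorem relabel_injective (e : I → I') (he : e.Injective) (h : ∀ i, c' (e i) = c i) {g : L → L'}
    (hg : g.Injective) : Function.Injective (relabel (c := c) (c' := c') e h g) := by
  intro t
  induction t with
  | leaf l =>
    rintro (l' | ⟨i', t'⟩) ht
    · exact congrArg leaf (hg (leaf.inj ht))
    · cases ht
  | node i t ih =>
    rintro (l' | ⟨i', t'⟩) ht
    · cases ht
    · simp only [relabel, node.injEq] at ht
      obtain ⟨hi, ht⟩ := ht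
      obtain rfl := he hi
      refine congrArg (node i) (funext fun k => ih k ?_)
      exact congrFun (eq_of_heq ht) (Fin.cast (h i).symm k)

end Plug

end PlanarTree

/-! ### Insertion of letters already seen and the lexicographic order. -/

/-- `InsertSeen S u u'`: the list `u'` is obtained from `u` by inserting elements that already
occurred, or that belong to `S`. -/
inductive InsertSeen {α : Type*} : Set α → List α → List α → Prop
  | nil (S : Set α) : InsertSeen S [] []
  | cons {S : Set α} {x : α} {u u' : List α} :
      InsertSeen (insert x S) u u' → InsertSeen S (x :: u) (x :: u')
  | skip {S : Set α} {x : α} {u u' : List α} :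
      x ∈ S → InsertSeen S u u' → InsertSeen S u (x :: u')

namespace InsertSeen

variable {α : Type*} {S T : Set α} {u u' w w' : List α}

theorem mono (h : InsertSeen S u u') (hST : S ⊆ T) : InsertSeen T u u' := by
  induction h generalizing T with
  | nil => exact .nil T
  | cons _ ih => exact .cons (ih (Set.insert_subset_insert hST))
  | skip hx _ ih => exact .skip (hST hx) (ih hST)

theorem append (h : InsertSeen S u u') (h' : InsertSeen S w w') :
    InsertSeen S (u ++ w) (u' ++ w') := by
  induction h with
  | nil => exact h'
  | cons _ ih => exact .cons (ih (h'.mono (Set.subset_insert _ _)))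
  | skip hx _ ih => exact .skip hx (ih h')

theorem flatten_ofFn {n : ℕ} {f g : Fin n → List α} (h : ∀ k, InsertSeen S (f k) (g k)) :
    InsertSeen S (List.ofFn f).flatten (List.ofFn g).flatten := by
  induction n with
  | zero => simpa using .nil S
  | succ n ih =>
    simp only [List.ofFn_succ, List.flatten_cons]
    exact (h 0).append (ih fun k => h k.succ)

/-- An insertion before the first place where `a` and `b` differ repeats a letter on which they
agree, so that place still decides the comparison. -/
theorem map_lt_map {β : Type*} [LinearOrder β] (h : InsertSeen S u u') {a b : α → β}
    (hS : ∀ x ∈ S, a x = b x) (hu : u.map a < u.map b) : u'.map a < u'.map b := by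
  induction h with
  | nil => exact hu
  | @cons S x u u' _ ih =>
    simp only [List.map_cons, List.cons_lt_cons_iff] at hu ⊢
    -- If `a x < b x` the comparison is already decided; otherwise `a x = b x`, and `x` joins the
    -- letters on which the two maps agree.
    refine hu.imp_right fun ⟨hx, hu⟩ => ⟨hx, ih ?_ hu⟩
    rintro y (rfl | hy)
    · exact hx
    · exact hS y hy
  | skip hx _ ih =>
    simp only [List.map_cons, List.cons_lt_cons_iff]
    exact Or.inr ⟨hS _ hx, ih hS hu⟩

end InsertSeen

/-! ### Preorder words of substitutions, and recovering the substituted trees. -/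

namespace PlanarTree

variable {I I' : Type} {c : I → ℕ} {c' : I' → ℕ} {L L' : Type}

theorem insertSeen_graft {S : Set I} {s : L → PlanarTree c' L'} {w : L → List I} {ι : I' → I}
    {a : PlanarTree c' L} (ha : ∀ x ∈ a.vertices, ι x ∈ S)
    (hs : ∀ l, InsertSeen S (w l) ((s l).vertices.map ι)) :
    InsertSeen S (a.leaves.flatMap w) ((graft s a).vertices.map ι) := by
  induction a with
  | leaf l => simpa [leaves, graft] using hs l
  | node j t ih =>
    simp only [leaves, graft, vertices, flatMap_flatten_ofFn, List.map_cons, List.map_flatten,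
      List.map_ofFn]
    exact .skip (ha j (mem_vertices_node.2 (Or.inl rfl))) (.flatten_ofFn fun k =>
      ih k fun x hx => ha x (mem_vertices_node.2 (Or.inr ⟨k, hx⟩)))

/-- The root of the tree inserted at `i` comes first in preorder and accounts for the letter `i`.
Its other vertices only repeat `i`, and planarity keeps the subtrees above in order. -/
theorem insertSeen_plug {u : ∀ i, PlanarTree c' (Fin (c i))} {ι : I' → I}
    (hι : ∀ i, ∀ x ∈ (u i).vertices, ι x = i) (hu : ∀ i, (u i).vertices ≠ [])
    (hl : ∀ i, (u i).leaves = List.finRange (c i)) (S : Set I) (t : PlanarTree c L) :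
    InsertSeen S t.vertices ((plug u t).vertices.map ι) := by
  induction t generalizing S with
  | leaf l => exact .nil S
  | node i t ih =>
    have hl := hl i
    have hι := hι i
    have hu := hu i
    simp only [plug, vertices]
    generalize u i = a at *
    cases a with
    | leaf l => exact absurd rfl hu
    | node j b =>
      simp only [graft, vertices, List.map_cons, List.map_flatten, List.map_ofFn]
      rw [hι j (mem_vertices_node.2 (Or.inl rfl))]
      refine .cons ?_
      have key := InsertSeen.flatten_ofFn (S := insert i S) fun k => insertSeen_graft (a := b k)
        (fun x hx => Or.inl (hι x (mem_vertices_node.2 (Or.inr ⟨k, hx⟩)))) fun l => ih l (insert i S)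
      -- Planarity of the inserted tree turns concatenation along its leaves into concatenation
      -- along the inputs of `i`.
      rwa [← flatMap_flatten_ofFn, ← leaves.eq_2 (c := c') j, hl, List.flatMap_def,
        ← List.ofFn_eq_map] at key

/-- The common tree is cut where `p` first fails or an end is reached. A root in `a` facing a leaf
of `a'` would be a vertex that both satisfies and violates `p`, so both cuts have the same shape. -/
theorem length_leaves_eq_of_graft_eq {p : I → Prop} {s s' : L → PlanarTree c L'}
    {a a' : PlanarTree c L} (ha : ∀ x ∈ a.vertices, p x) (ha' : ∀ x ∈ a'.vertices, p x)
    (hs : ∀ l, ∀ x ∈ (s l).vertices, ¬ p x) (hs' : ∀ l, ∀ x ∈ (s' l).vertices, ¬ p x)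
    (h : graft s a = graft s' a') : a.leaves.length = a'.leaves.length := by
  induction a generalizing a' with
  | leaf l =>
    cases a' with
    | leaf l' => rfl
    | node i' t' =>
      simp only [graft] at h
      exact absurd (ha' i' (mem_vertices_node.2 (Or.inl rfl)))
        (hs l i' (by rw [h]; exact mem_vertices_node.2 (Or.inl rfl)))
  | node i t ih =>
    cases a' with
    | leaf l' =>
      simp only [graft] at h
      exact absurd (ha i (mem_vertices_node.2 (Or.inl rfl)))
        (hs' l' i (by rw [← h]; exact mem_vertices_node.2 (Or.inl rfl)))
    | node i' t' =>
      simp only [graft, node.injEq] at h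
      obtain ⟨rfl, h⟩ := h
      simp only [leaves, List.length_flatten, List.map_ofFn]
      congr 2
      exact funext fun k => ih k (fun x hx => ha x (mem_vertices_node.2 (Or.inr ⟨k, hx⟩)))
        (fun x hx => ha' x (mem_vertices_node.2 (Or.inr ⟨k, hx⟩))) (congrFun (eq_of_heq h) k)

theorem eq_of_graft_eq {p : I → Prop} {s s' : L → PlanarTree c L'}
    {a a' : PlanarTree c L} (ha : ∀ x ∈ a.vertices, p x) (ha' : ∀ x ∈ a'.vertices, p x)
    (hs : ∀ l, ∀ x ∈ (s l).vertices, ¬ p x) (hs' : ∀ l, ∀ x ∈ (s' l).vertices, ¬ p x)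
    (h : graft s a = graft s' a') (hl : a.leaves = a'.leaves) : a = a' := by
  induction a generalizing a' with
  | leaf l =>
    cases a' with
    | leaf l' => simpa [leaves] using hl
    | node i' t' =>
      simp only [graft] at h
      exact absurd (ha' i' (mem_vertices_node.2 (Or.inl rfl)))
        (hs l i' (by rw [h]; exact mem_vertices_node.2 (Or.inl rfl)))
  | node i t ih =>
    cases a' with
    | leaf l' =>
      simp only [graft] at h
      exact absurd (ha i (mem_vertices_node.2 (Or.inl rfl)))
        (hs' l' i (by rw [← h]; exact mem_vertices_node.2 (Or.inl rfl)))
    | node i' t' =>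
      simp only [graft, node.injEq] at h
      obtain ⟨rfl, h⟩ := h
      have h := congrFun (eq_of_heq h)
      have hat k x (hx : x ∈ (t k).vertices) := ha x (mem_vertices_node.2 (Or.inr ⟨k, hx⟩))
      have hat' k x (hx : x ∈ (t' k).vertices) := ha' x (mem_vertices_node.2 (Or.inr ⟨k, hx⟩))
      have hlen k := length_leaves_eq_of_graft_eq (hat k) (hat' k) hs hs' (h k)
      -- Since corresponding branches have equally many leaves, equality of the concatenated leaf
      -- lists splits into equalities branch by branch.
      have hl := List.eq_iff_flatten_eq.2 ⟨hl, by
        simp only [List.map_ofFn]; exact congrArg _ (funext hlen)⟩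
      exact congrArg (node i) (funext fun k => ih k (hat k) (hat' k) (h k)
        (congrFun (List.ofFn_injective hl) k))

theorem eq_of_graft_eq_graft {s s' : L → PlanarTree c L'} {a : PlanarTree c L}
    (h : graft s a = graft s' a) {l : L} (hl : l ∈ a.leaves) : s l = s' l := by
  induction a with
  | leaf l' =>
    obtain rfl : l = l' := by simpa [leaves] using hl
    exact h
  | node i t ih =>
    obtain ⟨k, hl⟩ := mem_leaves_node.1 hl
    simp only [graft, node.injEq, heq_eq_eq, true_and] at h
    exact ih k (congrFun h k) hl

theorem nodup_vertices_node {i : I} {t : Fin (c i) → PlanarTree c L} :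
    (node i t).vertices.Nodup ↔ (∀ k, i ∉ (t k).vertices) ∧ (∀ k, (t k).vertices.Nodup) ∧
      Pairwise fun k k' => List.Disjoint (t k).vertices (t k').vertices := by
  simp only [vertices, List.nodup_cons, List.nodup_flatten, List.mem_flatten, List.mem_ofFn,
    List.pairwise_ofFn, exists_exists_eq_and, not_exists, forall_exists_index,
    forall_apply_eq_imp_iff]
  refine and_congr_right fun _ => and_congr_right fun _ => ⟨fun h k k' hk => ?_,
    fun h k k' hk => h hk.ne⟩
  obtain hk | hk := lt_or_gt_of_ne hk
  · exact h hk
  · exact (h hk).symm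

/-- The tree inserted at the root is the root region of vertices sent by `ι` to the root label, a
label that does not recur above. Cutting this region off leaves the same problem in each branch. -/
theorem eq_of_plug_eq_plug {u u' : ∀ i, PlanarTree c' (Fin (c i))} {ι : I' → I}
    (hι : ∀ i, ∀ x ∈ (u i).vertices, ι x = i) (hι' : ∀ i, ∀ x ∈ (u' i).vertices, ι x = i)
    (hl : ∀ i, (u i).leaves = List.finRange (c i)) (hl' : ∀ i, (u' i).leaves = List.finRange (c i))
    {t : PlanarTree c L} (ht : t.vertices.Nodup) (h : plug u t = plug u' t) {i : I}
    (hi : i ∈ t.vertices) : u i = u' i := by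
  induction t with
  | leaf l => simp [vertices] at hi
  | node j t ih =>
    obtain ⟨hj, hn, -⟩ := nodup_vertices_node.1 ht
    simp only [plug] at h
    have hu : u j = u' j := by
      refine eq_of_graft_eq (p := fun x => ι x = j) (hι j) (hι' j) (fun k x hx hxj => ?_)
        (fun k x hx hxj => ?_) h ((hl j).trans (hl' j).symm)
      · obtain ⟨i, hi, hx⟩ := mem_vertices_plug hx
        exact hj k (hxj ▸ (hι i x hx).symm ▸ hi)
      · obtain ⟨i, hi, hx⟩ := mem_vertices_plug hx
        exact hj k (hxj ▸ (hι' i x hx).symm ▸ hi)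
    obtain rfl | ⟨k, hi⟩ := mem_vertices_node.1 hi
    · exact hu
    · rw [← hu] at h
      exact ih k (hn k) (eq_of_graft_eq_graft h (by rw [hl]; exact List.mem_finRange k)) hi

end PlanarTree

/-! ### Order embeddings and sums of leaf counts. -/

theorem List.SublistForall₂.exists_orderEmbedding {α β : Type*} {R : α → β → Prop}
    {l₁ : List α} {l₂ : List β} (h : List.SublistForall₂ R l₁ l₂) :
    ∃ φ : Fin l₁.length ↪o Fin l₂.length, ∀ k, R (l₁.get k) (l₂.get (φ k)) := by
  obtain ⟨l, hl, hs⟩ := List.sublistForall₂_iff.1 h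
  obtain ⟨φ, hφ⟩ := List.sublist_iff_exists_fin_orderEmbedding_get_eq.1 hs
  refine ⟨(Fin.castOrderIso hl.length_eq).toOrderEmbedding.trans φ, fun k => ?_⟩
  have := hl.get k.2 (hl.length_eq ▸ k.2)
  convert! this using 1
  exact (hφ _).symm

theorem List.SublistForall₂.exists_orderEmbedding_of_ofFn {α β : Type*} {R : α → β → Prop}
    {m n : ℕ} {f : Fin m → α} {g : Fin n → β}
    (h : List.SublistForall₂ R (List.ofFn f) (List.ofFn g)) :
    ∃ φ : Fin m ↪o Fin n, ∀ k, R (f k) (g (φ k)) := by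
  obtain ⟨φ, hφ⟩ := h.exists_orderEmbedding
  refine ⟨((Fin.castOrderIso (List.length_ofFn (f := f)).symm).toOrderEmbedding.trans φ).trans
    (Fin.castOrderIso (List.length_ofFn (f := g))).toOrderEmbedding, fun k => ?_⟩
  have := hφ (Fin.cast (List.length_ofFn (f := f)).symm k)
  simp only [List.get_ofFn] at this
  exact this

theorem sum_le_sum_of_embedding {ι κ : Type*} [Fintype ι] [Fintype κ] (φ : ι ↪ κ) {f : ι → ℕ}
    {g : κ → ℕ} (h : ∀ k, f k ≤ g (φ k)) : ∑ k, f k ≤ ∑ k, g k :=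
  (Finset.sum_le_sum fun k _ => h k).trans <| by
    rw [← Finset.sum_map Finset.univ φ g]
    exact Finset.sum_le_sum_of_subset (Finset.subset_univ _)

theorem eq_and_eq_zero_of_sum_eq_sum {ι κ : Type*} [Fintype ι] [Fintype κ] (φ : ι ↪ κ) {f : ι → ℕ}
    {g : κ → ℕ} (h : ∀ k, f k ≤ g (φ k)) (hs : ∑ k, f k = ∑ k, g k) :
    (∀ k, f k = g (φ k)) ∧ ∀ k, k ∉ Set.range φ → g k = 0 := by
  classical
  have h₁ : ∑ k, f k ≤ ∑ k, g (φ k) := Finset.sum_le_sum fun k _ => h k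
  have h₂ : ∑ k, g (φ k) + ∑ k ∈ Finset.univ \ Finset.univ.map φ, g k = ∑ k, g k := by
    rw [← Finset.sum_map Finset.univ φ g, add_comm]
    exact Finset.sum_sdiff (Finset.subset_univ _)
  constructor
  · have := (Finset.sum_eq_sum_iff_of_le (fun k _ => h k)).1 (by omega : ∑ k, f k = ∑ k, g (φ k))
    exact fun k => this k (Finset.mem_univ k)
  · intro k hk
    have : ∑ k ∈ Finset.univ \ Finset.univ.map φ, g k = 0 := by omega
    exact Finset.sum_eq_zero_iff.1 this k (by simpa using hk)

/-- An entry `x` of the `k`-th list satisfies `φ x = k`, so the concatenation is strictly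
increasing; it also contains every element. -/
theorem flatten_ofFn_eq_finRange {m n : ℕ} (φ : Fin m ↪o Fin n) {g : Fin n → List (Fin m)}
    (h : ∀ k, g (φ k) = [k]) (h' : ∀ k, k ∉ Set.range φ → g k = []) :
    (List.ofFn g).flatten = List.finRange m := by
  have hg : ∀ k, ∀ x ∈ g k, φ x = k := fun k x hx => by
    by_cases hk : k ∈ Set.range φ
    · obtain ⟨j, rfl⟩ := hk
      rw [h, List.mem_singleton] at hx
      rw [hx]
    · simp [h' k hk] at hx
  refine List.Pairwise.eq_of_mem_iff (r := (· < ·)) ?_ (List.sortedLT_finRange m).pairwise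
    fun x => ?_
  · rw [List.pairwise_flatten, List.pairwise_ofFn]
    refine ⟨?_, fun i j hij x hx y hy => ?_⟩
    · simp only [List.mem_ofFn, forall_exists_index, forall_apply_eq_imp_iff]
      intro k
      by_cases hk : k ∈ Set.range φ
      · obtain ⟨j, rfl⟩ := hk
        simp [h]
      · simp [h' k hk]
    · exact φ.lt_iff_lt.1 (by rwa [hg i x hx, hg j y hy])
  · simp only [List.mem_flatten, List.mem_ofFn, exists_exists_eq_and, List.mem_finRange, iff_true]
    exact ⟨φ x, by simp [h]⟩

/-! ### Kruskal embeddings as substitutions. -/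

namespace PlanarTree

section Emb

variable {I I' I'' : Type} {c : I → ℕ} {c' : I' → ℕ} {c'' : I'' → ℕ} {L M : Type}

/-- Kruskal's embedding relation for planar trees with labelled leaves; the labels of vertices are
ignored. -/
inductive Emb : PlanarTree c L → PlanarTree c' L → Prop
  | leaf (l : L) : Emb (leaf l) (leaf l)
  | skip {t : PlanarTree c L} {i : I'} {t' : Fin (c' i) → PlanarTree c' L} (k : Fin (c' i)) :
      Emb t (t' k) → Emb t (node i t')
  | node {i : I} {t : Fin (c i) → PlanarTree c L} {i' : I'} {t' : Fin (c' i') → PlanarTree c' L}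
      (φ : Fin (c i) ↪o Fin (c' i')) : (∀ k, Emb (t k) (t' (φ k))) → Emb (node i t) (node i' t')

theorem Emb.refl (t : PlanarTree c L) : Emb t t := by
  induction t with
  | leaf l => exact .leaf l
  | node i t ih => exact .node (RelEmbedding.refl _) ih

theorem Emb.trans {t : PlanarTree c L} {t' : PlanarTree c' L} {t'' : PlanarTree c'' L}
    (h : Emb t t') (h' : Emb t' t'') : Emb t t'' := by
  induction h' generalizing t with
  | leaf l =>
    cases h
    exact .leaf l
  | skip k _ ih => exact .skip k (ih h)
  | node φ _ ih =>
    cases h with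
    | skip k h => exact .skip (φ k) (ih k h)
    | node ψ h => exact .node (ψ.trans φ) fun k => ih (ψ k) (h k)

theorem length_leaves_node (i : I) (t : Fin (c i) → PlanarTree c L) :
    (node i t).leaves.length = ∑ k, (t k).leaves.length := by
  simp only [leaves, List.length_flatten, List.map_ofFn, List.sum_ofFn]
  rfl

theorem Emb.length_leaves_le {t : PlanarTree c L} {t' : PlanarTree c' L} (h : Emb t t') :
    t.leaves.length ≤ t'.leaves.length := by
  induction h with
  | leaf l => exact le_rfl
  | @skip t i t' k _ ih =>
    rw [length_leaves_node]
    exact ih.trans (Finset.single_le_sum (f := fun k => (t' k).leaves.length)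
      (fun _ _ => Nat.zero_le _) (Finset.mem_univ k))
  | node φ _ ih =>
    rw [length_leaves_node, length_leaves_node]
    exact sum_le_sum_of_embedding φ.toEmbedding ih

/-- In a tree without leaves, the type of labels of leaves may be changed. -/
theorem exists_graft_eq_of_leaves_eq_nil {t : PlanarTree c L} (ht : t.leaves.length = 0)
    (M : Type) : ∃ t' : PlanarTree c M, t'.leaves = [] ∧ ∀ s : M → PlanarTree c L, graft s t' = t := by
  induction t with
  | leaf l => simp [leaves] at ht
  | node i t ih =>
    rw [length_leaves_node, Finset.sum_eq_zero_iff] at ht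
    choose t' ht' hs using fun k => ih k (ht k (Finset.mem_univ k))
    exact ⟨node i t', by simp [leaves, ht'], fun s => congrArg (node i) (funext fun k => hs k s)⟩

theorem length_leaves_of_skip {n : ℕ} {i : I} {t : Fin (c i) → PlanarTree c L} {k : Fin (c i)}
    (hn : n ≤ (t k).leaves.length) (h : n = (node i t).leaves.length) :
    n = (t k).leaves.length ∧ ∀ k' ≠ k, (t k').leaves.length = 0 := by
  rw [length_leaves_node] at h
  -- The chosen branch `k` is treated as the image of a one-point set, so the other branches
  -- contribute no leaves.
  obtain ⟨h₁, h₂⟩ := eq_and_eq_zero_of_sum_eq_sum (ι := Unit)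
    (f := fun _ => n) (g := fun k => (t k).leaves.length)
    ⟨fun _ => k, fun _ _ _ => rfl⟩ (fun _ => hn) (by simpa using h)
  exact ⟨h₁ (), fun k' hk' => h₂ k' (by rintro ⟨_, rfl⟩; exact hk' rfl)⟩

theorem length_leaves_of_node {i : I} {t : Fin (c i) → PlanarTree c L} {i' : I'}
    {t' : Fin (c' i') → PlanarTree c' L} (φ : Fin (c i) ↪o Fin (c' i'))
    (hφ : ∀ k, Emb (t k) (t' (φ k)))
    (h : (node i t).leaves.length = (node i' t').leaves.length) :
    (∀ k, (t k).leaves.length = (t' (φ k)).leaves.length) ∧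
      ∀ k, k ∉ Set.range φ → (t' k).leaves.length = 0 := by
  rw [length_leaves_node, length_leaves_node] at h
  exact eq_and_eq_zero_of_sum_eq_sum φ.toEmbedding (fun k => (hφ k).length_leaves_le) h

/-- This supplies default values for families indexed by all vertices. Only `c i = 0` is delicate:
the part of the larger tree facing such a vertex has no leaves, and hence serves as the default. -/
theorem Emb.nonempty {t : PlanarTree c L} {t' : PlanarTree c' L} (h : Emb t t')
    (hl : t.leaves.length = t'.leaves.length) {i : I} (hi : i ∈ t.vertices) :
    Nonempty (PlanarTree c' (Fin (c i))) := by
  induction h with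
  | leaf l => simp [vertices] at hi
  | skip k h ih => exact ih (length_leaves_of_skip h.length_leaves_le hl).1 hi
  | @node j t i' t' φ h ih =>
    obtain rfl | ⟨k, hi⟩ := mem_vertices_node.1 hi
    · obtain h0 | h0 := Nat.eq_zero_or_pos (c i)
      · have : (PlanarTree.node i' t').leaves.length = 0 := by
          rw [← hl, length_leaves_node, Finset.sum_eq_zero]
          intro k
          exact absurd k.2 (by omega)
        exact ⟨(exists_graft_eq_of_leaves_eq_nil this _).choose⟩
      · exact ⟨.leaf ⟨0, h0⟩⟩
    · exact ih k ((length_leaves_of_node φ h hl).1 k) hi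

/-- An embedding of trees with the same number of leaves presents the larger tree as a substitution
of trees into the vertices of the smaller one, up to an additional tree with one leaf below the
root. -/
theorem Emb.exists_graft_plug (u₀ : ∀ i, PlanarTree c' (Fin (c i))) {t : PlanarTree c L}
    {t' : PlanarTree c' L} (h : Emb t t') (hl : t.leaves.length = t'.leaves.length)
    (ht : t.vertices.Nodup) :
    ∃ (a : PlanarTree c' Unit) (u : ∀ i, PlanarTree c' (Fin (c i))), a.leaves.length = 1 ∧
      (∀ i ∈ t.vertices, (u i).leaves = List.finRange (c i) ∧ (u i).vertices ≠ []) ∧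
      graft (fun _ => plug u t) a = t' := by
  classical
  induction h with
  | leaf l => exact ⟨.leaf (), u₀, rfl, by simp [vertices], rfl⟩
  | @skip t i t' k h ih =>
    obtain ⟨hk, h0⟩ := length_leaves_of_skip h.length_leaves_le hl
    obtain ⟨a, u, ha, hu, rfl'⟩ := ih hk ht
    choose b hb hb' using fun k' => fun hk' : k' ≠ k =>
      exists_graft_eq_of_leaves_eq_nil (h0 k' hk') Unit
    -- The skipped vertex extends the stem: its input `k` continues to the single leaf, and its
    -- other inputs carry leafless branches.
    refine ⟨PlanarTree.node i fun k' => if hk' : k' = k then a else b k' hk', u, ?_, hu, ?_⟩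
    · rw [length_leaves_node, Finset.sum_eq_single k]
      · simp [ha]
      · intro k' _ hk'
        simp [hk', hb]
      · simp
    · refine congrArg (PlanarTree.node i) (funext fun k' => ?_)
      by_cases hk' : k' = k
      · subst hk'
        simp [rfl']
      · simp [hk', hb']
  | @node i t i' t' φ h ih =>
    obtain ⟨hk, h0⟩ := length_leaves_of_node φ h hl
    obtain ⟨hi, hn, hd⟩ := nodup_vertices_node.1 ht
    choose a u ha hu hs using fun k => ih k (hk k) (hn k)
    choose b hb hb' using fun k' => fun hk' : k' ∉ Set.range φ =>
      exists_graft_eq_of_leaves_eq_nil (h0 k' hk') (Fin (c i))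
    -- The tree for the root `i`: inputs hit by `φ` carry the stems of the branches, each ending in
    -- the leaf of its branch, while the missed inputs carry leafless trees.
    let r : PlanarTree c' (Fin (c i)) := PlanarTree.node i' fun k' =>
      if hk' : k' ∈ Set.range φ then graft (fun _ => .leaf hk'.choose) (a hk'.choose)
      else b k' hk'
    -- A vertex label lies in at most one branch, so the families obtained for the branches glue.
    let w : ∀ j, PlanarTree c' (Fin (c j)) := fun j =>
      if hj : ∃ k, j ∈ (t k).vertices then u hj.choose j else u₀ j
    have hw : ∀ k, ∀ j ∈ (t k).vertices, w j = u k j := fun k j hj => by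
      have hj' : ∃ k, j ∈ (t k).vertices := ⟨k, hj⟩
      have : hj'.choose = k := by
        by_contra hne
        exact hd hne hj'.choose_spec hj
      simp only [w, dif_pos hj', this]
    have hv : ∀ k, ∀ j ∈ (t k).vertices, Function.update w i r j = u k j := fun k j hj => by
      rw [Function.update_of_ne (by rintro rfl; exact hi k hj), hw k j hj]
    refine ⟨.leaf (), Function.update w i r, rfl, fun j hj => ?_, ?_⟩
    · obtain rfl | ⟨k, hj⟩ := mem_vertices_node.1 hj
      · rw [Function.update_self]
        refine ⟨flatten_ofFn_eq_finRange φ (fun k => ?_) fun k hk => ?_, by simp [r, vertices]⟩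
        · have hk' : φ k ∈ Set.range φ := ⟨k, rfl⟩
          have : hk'.choose = k := φ.injective hk'.choose_spec
          obtain ⟨x, hx⟩ := List.length_eq_one_iff.1 (ha k)
          simp only [dif_pos hk', this, leaves_graft, hx]
          rfl
        · simp only [dif_neg hk, hb]
      · rw [hv k j hj]
        exact hu k j hj
    · simp only [graft, plug, Function.update_self, r]
      refine congrArg (PlanarTree.node i') (funext fun k' => ?_)
      by_cases hk' : k' ∈ Set.range φ
      · rw [dif_pos hk', graft_graft]
        simp only [graft]
        rw [plug_congr (hv hk'.choose), hs, hk'.choose_spec]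
      · rw [dif_neg hk', hb']

theorem Emb.exists_plug_eq {t : PlanarTree c L} {t' : PlanarTree c' L} (h : Emb t t')
    (hl : t.leaves.length = t'.leaves.length) (ht : t.vertices.Nodup) (ht' : ∀ i, i ∈ t.vertices)
    (hne : t.vertices ≠ []) :
    ∃ u : ∀ i, PlanarTree c' (Fin (c i)),
      (∀ i, (u i).leaves = List.finRange (c i) ∧ (u i).vertices ≠ []) ∧ plug u t = t' := by
  classical
  obtain ⟨a, u, ha, hu, hs⟩ :=
    h.exists_graft_plug (fun i => (h.nonempty hl (ht' i)).some) hl ht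
  cases t with
  | leaf l => exact absurd rfl hne
  | node i t =>
    have hi := (nodup_vertices_node.1 ht).1
    -- The stem below the root is absorbed into the tree substituted for the root vertex; the label
    -- `i` does not recur, so nothing else changes.
    refine ⟨Function.update u i (graft (fun _ => u i) a), fun j => ?_, ?_⟩
    · by_cases hj : j = i
      · subst hj
        rw [Function.update_self]
        obtain ⟨x, hx⟩ := List.length_eq_one_iff.1 ha
        obtain ⟨y, hy⟩ := List.exists_mem_of_ne_nil _ (hu j (ht' j)).2
        exact ⟨by simp [leaves_graft, hx, (hu j (ht' j)).1], List.ne_nil_of_mem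
          ((mem_vertices_graft _ _).2 (Or.inr ⟨x, by simp [hx], hy⟩))⟩
      · rw [Function.update_of_ne hj]
        exact hu j (ht' j)
    · rw [← hs]
      simp only [plug, Function.update_self, graft_graft]
      congr 1
      funext _
      congr 1
      funext k
      exact plug_congr fun j hj => Function.update_of_ne (by rintro rfl; exact hi k hj) _ _

end Emb

end PlanarTree

/-! ### Kruskal's tree theorem. -/

/-- Planar trees with leaves labelled by `L`, over arbitrary sets of labels of vertices. -/
structure LeafLabelledTree (L : Type) : Type 1 where
  {Label : Type}
  {valence : Label → ℕ}
  tree : PlanarTree valence L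

namespace LeafLabelledTree

open PlanarTree

variable {L : Type}

/-- Kruskal's embedding relation. -/
def Emb (x y : LeafLabelledTree L) : Prop := x.tree.Emb y.tree

instance : IsPreorder (LeafLabelledTree L) Emb where
  refl x := PlanarTree.Emb.refl x.tree
  trans _ _ _ := PlanarTree.Emb.trans

/-- The subtrees above the root vertex. -/
def children : LeafLabelledTree L → List (LeafLabelledTree L)
  | ⟨.leaf _⟩ => []
  | ⟨.node _ t⟩ => List.ofFn fun k => ⟨t k⟩

/-- The label of a tree without vertices. -/
def leafLabel : LeafLabelledTree L → Option L
  | ⟨.leaf l⟩ => some l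
  | ⟨.node _ _⟩ => none

theorem emb_of_mem_children {x y z : LeafLabelledTree L} (hy : y ∈ z.children) (h : Emb x y) :
    Emb x z := by
  obtain ⟨l | ⟨i, t⟩⟩ := z
  · simp [children] at hy
  · obtain ⟨k, rfl⟩ := List.mem_ofFn.1 hy
    exact PlanarTree.Emb.skip k h

theorem length_vertices_lt_of_mem_children {y z : LeafLabelledTree L} (hy : y ∈ z.children) :
    y.tree.vertices.length < z.tree.vertices.length := by
  obtain ⟨l | ⟨i, t⟩⟩ := z
  · simp [children] at hy
  · obtain ⟨k, rfl⟩ := List.mem_ofFn.1 hy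
    simp only [vertices, List.length_cons, List.length_flatten, List.map_ofFn, List.sum_ofFn]
    exact Nat.lt_succ_of_le (Finset.single_le_sum (f := fun k => (t k).vertices.length)
      (fun _ _ => Nat.zero_le _) (Finset.mem_univ k))

/-- The leaf label is needed because a leaf and a vertex without inputs both have an empty list of
children. -/
theorem emb_of_children {x y : LeafLabelledTree L} (hl : x.leafLabel = y.leafLabel)
    (h : List.SublistForall₂ Emb x.children y.children) : Emb x y := by
  obtain ⟨l | ⟨i, t⟩⟩ := x <;> obtain ⟨l' | ⟨i', t'⟩⟩ := y <;> simp only [leafLabel] at hl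
  · obtain rfl := Option.some.inj hl
    exact .leaf l
  · cases hl
  · cases hl
  · obtain ⟨φ, hφ⟩ := h.exists_orderEmbedding_of_ofFn
    exact .node φ hφ

/-- **Kruskal's tree theorem** for planar trees with leaves labelled by a finite set. -/
theorem wellQuasiOrdered_emb [Finite L] : WellQuasiOrdered (Emb (L := L)) := by
  rw [← Set.partiallyWellOrderedOn_univ_iff, Set.PartiallyWellOrderedOn.iff_not_exists_isMinBadSeq
    fun x : LeafLabelledTree L => x.tree.vertices.length]
  rintro ⟨f, ⟨-, hf⟩, hmin⟩
  -- Nash-Williams' argument: subtrees above the roots of a minimal bad sequence are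
  -- well-quasi-ordered.
  have hs : {x | ∃ n, x ∈ (f n).children}.PartiallyWellOrderedOn Emb := by
    rw [Set.partiallyWellOrderedOn_iff_exists_lt]
    intro g hg
    choose m hm using hg
    by_contra! hbad
    obtain ⟨k₀, hk₀⟩ : ∃ k₀, ∀ k, m k₀ ≤ m k := by
      obtain ⟨_, ⟨k₀, rfl⟩, h⟩ := WellFounded.has_min (wellFounded_lt (α := ℕ)) (Set.range m)
        ⟨m 0, 0, rfl⟩
      exact ⟨k₀, fun k => not_lt.1 (h (m k) ⟨k, rfl⟩)⟩
    -- A bad sequence `g` of children, started at `k₀` where the parent index `m` is least, replaces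
    -- the tail of `f` from `m k₀` on. The new sequence is bad, because embedding into a child gives
    -- embedding into its parent, and its entry at `m k₀` has fewer vertices.
    refine hmin (m k₀) (fun n => if n < m k₀ then f n else g (k₀ + (n - m k₀)))
      (fun n hn => (if_pos hn).symm) ?_ ⟨fun _ => trivial, fun i j hij => ?_⟩
    · beta_reduce
      rw [if_neg (lt_irrefl _), Nat.sub_self]
      exact length_vertices_lt_of_mem_children (hm k₀)
    · dsimp only
      split_ifs with hi hj hj
      · exact hf i j hij
      · exact fun h => hf i _ (hi.trans_le (hk₀ _)) (emb_of_mem_children (hm _) h)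
      · omega
      · exact hbad _ _ (by omega)
  have : IsPreorder (List (LeafLabelledTree L)) (List.SublistForall₂ Emb) :=
    { refl := Std.Refl.refl, trans := IsTrans.trans }
  -- Higman's lemma gives a subsequence with monotone lists of children; finiteness of `Option L`
  -- then provides two terms with equal leaf labels.
  obtain ⟨g, hg⟩ := (Set.PartiallyWellOrderedOn.partiallyWellOrderedOn_sublistForall₂ Emb
    hs).exists_monotone_subseq (f := fun n => (f n).children) fun n x hx => ⟨n, hx⟩
  obtain ⟨i, j, hij, h⟩ :=
    Finite.wellQuasiOrdered (α := Option L) (· = ·) fun n => (f (g n)).leafLabel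
  exact hf (g i) (g j) (g.strictMono hij) (emb_of_children h (hg i j hij.le))

end LeafLabelledTree

/-! ### Compatibilities of substitution, grafting and relabelling. -/

namespace PlanarTree

variable {I I' I'' : Type} {c : I → ℕ} {c' : I' → ℕ} {c'' : I'' → ℕ} {L L' : Type}

theorem plug_graft (u : ∀ i, PlanarTree c' (Fin (c i))) (s : L → PlanarTree c L')
    (t : PlanarTree c L) : plug u (graft s t) = graft (fun l => plug u (s l)) (plug u t) := by
  induction t with
  | leaf l => rfl
  | node i t ih => simp only [graft, plug, graft_graft, ih]

theorem plug_plug (u : ∀ i, PlanarTree c'' (Fin (c' i))) (v : ∀ i, PlanarTree c' (Fin (c i)))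
    (t : PlanarTree c L) : plug u (plug v t) = plug (fun i => plug u (v i)) t := by
  induction t with
  | leaf l => rfl
  | node i t ih => simp only [plug, plug_graft, ih]

/-- Change of labels of leaves. -/
abbrev mapLeaves (g : L → L') (t : PlanarTree c L) : PlanarTree c L' :=
  relabel (c' := c) id (fun _ => rfl) g t

theorem plug_mapLeaves (u : ∀ i, PlanarTree c' (Fin (c i))) (g : L → L') (t : PlanarTree c L) :
    plug u (mapLeaves g t) = mapLeaves g (plug u t) := by
  induction t with
  | leaf l => rfl
  | node i t ih =>
    simp only [mapLeaves, relabel, plug, relabel_graft]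
    exact congrArg₂ graft (funext ih) (relabel_refl (u i)).symm

theorem graft_leaf_eq_mapLeaves (g : L → L') (t : PlanarTree c L) :
    graft (fun l => leaf (g l)) t = mapLeaves g t := by
  induction t with
  | leaf l => rfl
  | node i t ih => exact congrArg (node i) (funext ih)

theorem leafCount_plug {u : ∀ i, PlanarTree c' (Fin (c i))} (hu : ∀ i k, leafCount k (u i) = 1)
    (l : L) (t : PlanarTree c L) : leafCount l (plug u t) = leafCount l t := by
  induction t with
  | leaf l => rfl
  | node i t ih => simp only [plug, leafCount_graft, leafCount, hu, one_mul, ih]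

theorem Emb.relabel (e : I → I') (t : PlanarTree (fun i => c' (e i)) L) :
    Emb t (PlanarTree.relabel (c' := c') e (fun _ => rfl) id t) := by
  induction t with
  | leaf l => exact .leaf l
  | node i t ih => exact .node (RelEmbedding.refl _) ih

theorem exists_perm_map_eq_finRange {n : ℕ} {l : List (Fin n)} (hl : l.Nodup)
    (h : ∀ k, k ∈ l) : ∃ σ : Equiv.Perm (Fin n), l.map σ = List.finRange n := by
  let e := hl.getEquivOfForallMemList l h
  have hn : l.length = n := by simpa using Fintype.card_congr e
  refine ⟨e.symm.trans (finCongr hn), List.ext_getElem (by simp [hn]) fun k h₁ h₂ => ?_⟩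
  have hk : k < l.length := by simpa using h₁
  have : e.symm l[k] = ⟨k, hk⟩ := e.symm_apply_eq.2 rfl
  simp [this]

end PlanarTree

/-! ### 2-level trees as families of substituted trees. -/

namespace SetOperad

open PlanarTree

namespace Operation

/-- The operadic tree underlying an operation of `sOp`. -/
def tree (p : sOp.nu.Operation) : PlanarTree p.inColour (Fin p.outColour) := p.op.1.1

theorem isOperadic_tree (p : sOp.nu.Operation) : p.tree.IsOperadic := p.op.1.2

end Operation

namespace TwoLevelTree

variable {p q r : sOp.nu.Operation}

/-- The operadic trees marking the upper vertices of a 2-level tree. -/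
def tree (f : TwoLevelTree q p) (i : Fin p.arity) :
    PlanarTree q.inColour (Fin (p.inColour i)) :=
  relabel (c' := q.inColour) Subtype.val (fun _ => rfl) _root_.id (f.upper i).1.1

theorem mem_vertices_tree (f : TwoLevelTree q p) {i : Fin p.arity} {j : Fin q.arity} :
    j ∈ (f.tree i).vertices ↔ f.index j = i := by
  rw [tree, vertices_relabel, List.mem_map]
  exact ⟨fun ⟨x, _, hx⟩ => hx ▸ x.2, fun h => ⟨⟨j, h⟩, (f.upper i).1.2.mem_vertices _, rfl⟩⟩

theorem vertices_tree_ne_nil (f : TwoLevelTree q p) (i : Fin p.arity) :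
    (f.tree i).vertices ≠ [] := by
  obtain ⟨j⟩ := (f.upper i).2
  exact List.ne_nil_of_mem (f.mem_vertices_tree.2 j.2)

theorem leaves_tree (f : TwoLevelTree q p) (i : Fin p.arity) :
    (f.tree i).leaves = (f.upper i).1.1.leaves := by
  rw [tree, leaves_relabel, List.map_id]

theorem mapLeaves_plug_tree (f : TwoLevelTree q p) :
    mapLeaves (Fin.cast f.out_eq) (plug f.tree p.tree) = q.tree := by
  have h : relabel (c := fun x : Σ i, {j // f.index j = i} => q.inColour x.2.1)
      (Equiv.sigmaFiberEquiv f.index) (colour_fibre f.index q.inColour) (Fin.cast f.out_eq)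
      (subst (fun i => (f.upper i).1.1) p.tree) = q.tree :=
    congrArg (fun x => x.1.1) f.comp_eq
  rw [← h]
  have h' := relabel_subst (c' := q.inColour) (Equiv.sigmaFiberEquiv f.index)
    (colour_fibre f.index q.inColour) (fun i => (f.upper i).1.1) p.tree
  refine (congrArg (mapLeaves (Fin.cast f.out_eq)) h'.symm).trans ?_
  exact relabel_relabel (c'' := q.inColour) _ _ _ _ _ _ _ _

theorem tree_comp (g : TwoLevelTree r q) (f : TwoLevelTree q p) (i : Fin p.arity) :
    (g.comp f).tree i = plug g.tree (f.tree i) := by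
  refine (relabel_relabel (c'' := r.inColour) _ _ _ _ _ _ (fun _ => rfl) _).trans ?_
  refine (relabel_subst (c := fun j : {j // f.index j = i} => q.inColour j.1)
    (d := fun j (k : {k // g.index k = j.1}) => r.inColour k.1) (c' := r.inColour)
    (fun x => (fibreCompEquiv g.index f.index i x).1) (fun _ => rfl)
    (fun j => (g.upper j.1).1.1) (f.upper i).1.1).trans ?_
  exact (plug_relabel_vertices (c := q.inColour) Subtype.val g.tree (f.upper i).1.1).symm

theorem tree_injective : Function.Injective (tree (p := p) (q := q)) := by
  intro f f' h
  have hi : f.index = f'.index := funext fun j =>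
    (f'.mem_vertices_tree.1 (h ▸ f.mem_vertices_tree.2 rfl)).symm
  obtain ⟨index, upper, out_eq, comp_eq⟩ := f
  obtain ⟨index', upper', out_eq', comp_eq'⟩ := f'
  obtain rfl : index = index' := hi
  obtain rfl : upper = upper' := funext fun i => Subtype.ext (Subtype.ext
    (relabel_injective (c' := q.inColour) Subtype.val Subtype.val_injective (fun _ => rfl)
      Function.injective_id (congrFun h i)))
  rfl

/-- Every vertex of `q` occurs exactly once among all the `u i`, because it occurs once in `q` and
each `u i` is inserted once. This defines the index map, and each `u i` then restricts to an
operadic tree on its fibre. -/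
theorem exists_tree_eq (u : ∀ i, PlanarTree q.inColour (Fin (p.inColour i)))
    (hl : ∀ i k, leafCount k (u i) = 1) (hne : ∀ i, (u i).vertices ≠ [])
    (h₀ : p.outColour = q.outColour) (hu : mapLeaves (Fin.cast h₀) (plug u p.tree) = q.tree) :
    ∃ f : TwoLevelTree q p, f.tree = u := by
  have hsum : ∀ j, ∑ i, vertexCount j (u i) = 1 := fun j => by
    have h := vertexCount_plug hl j p.tree
    simp only [p.isOperadic_tree.1, one_mul] at h
    rw [← h, ← q.isOperadic_tree.1 j, ← hu, mapLeaves]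
    exact (vertexCount_relabel (c' := q.inColour) _root_.id Function.injective_id _ _ _ _).symm
  have hex : ∀ j, ∃ i, j ∈ (u i).vertices := fun j => by
    by_contra! h
    have := hsum j
    rw [Finset.sum_eq_zero fun i _ => by_contra fun hi => h i (vertexCount_ne_zero.1 hi)] at this
    exact zero_ne_one this
  choose index hindex using hex
  -- Occurrences in two different trees would make the sum `hsum` at least two.
  have huniq : ∀ j i, j ∈ (u i).vertices → index j = i := fun j i hj => by
    by_contra hne
    have h₁ := Nat.pos_of_ne_zero (vertexCount_ne_zero.2 hj)
    have h₂ := Nat.pos_of_ne_zero (vertexCount_ne_zero.2 (hindex j))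
    have h₃ := Finset.add_le_sum (s := Finset.univ) (f := fun i => vertexCount j (u i))
      (fun _ _ => Nat.zero_le _) (Finset.mem_univ (index j)) (Finset.mem_univ i) hne
    rw [hsum j] at h₃
    omega
  have hcount : ∀ j, vertexCount j (u (index j)) = 1 := fun j => by
    rw [← hsum j, Finset.sum_eq_single (index j)]
    · exact fun i _ hi => by_contra fun h => hi (huniq j i (vertexCount_ne_zero.1 h)).symm
    · simp
  choose t ht using fun i => exists_relabel_val_eq (fun j => index j = i) (u i)
    fun j hj => huniq j i hj
  have hop : ∀ i, (t i).IsOperadic := fun i => by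
    refine ⟨fun ⟨j, hj⟩ => ?_, fun k => ?_⟩
    · subst hj
      rw [← hcount j, ← ht (index j)]
      exact (vertexCount_relabel (c' := q.inColour) Subtype.val Subtype.val_injective
        (fun _ => rfl) _root_.id (⟨j, rfl⟩ : {j' // index j' = index j})
        (t (index j))).symm
    · rw [← hl i k, ← ht i]
      exact (leafCount_relabel (c' := q.inColour) Subtype.val (fun _ => rfl) _root_.id
        Function.injective_id _ _).symm
  refine ⟨⟨index, fun i => ⟨⟨t i, hop i⟩, ?_⟩, h₀, ?_⟩, funext ht⟩
  · obtain ⟨j, hj⟩ := List.exists_mem_of_ne_nil _ (hne i)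
    exact ⟨⟨j, huniq j i hj⟩⟩
  · refine Subtype.ext (Subtype.ext (Eq.trans ?_ hu))
    have h' := relabel_subst (c' := q.inColour) (Equiv.sigmaFiberEquiv index)
      (colour_fibre index q.inColour) t p.tree
    refine Eq.trans ?_ (congrArg (mapLeaves (Fin.cast h₀)) (h'.trans ?_))
    · exact (relabel_relabel (c' := q.inColour) (c'' := q.inColour)
        (Equiv.sigmaFiberEquiv index) (colour_fibre index q.inColour) _root_.id _root_.id
        (fun _ => rfl) (Fin.cast h₀) (colour_fibre index q.inColour)
        (subst (d := fun i (j : {j // index j = i}) => q.inColour j.1) t p.tree)).symm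
    · exact congrArg (fun u => plug u p.tree) (funext ht)

/-- A 2-level tree `g` factors through `f` when its upper trees are obtained by substitution from
those of `f`. -/
theorem exists_comp_eq (f : TwoLevelTree q p) (g : TwoLevelTree r p)
    (u : ∀ j, PlanarTree r.inColour (Fin (q.inColour j)))
    (hl : ∀ j k, leafCount k (u j) = 1) (hne : ∀ j, (u j).vertices ≠ [])
    (hu : ∀ i, plug u (f.tree i) = g.tree i) :
    ∃ h : TwoLevelTree r q, h.tree = u ∧ h.comp f = g := by
  obtain ⟨h, hh⟩ := exists_tree_eq u hl hne (f.out_eq.symm.trans g.out_eq) (by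
    rw [← f.mapLeaves_plug_tree, ← g.mapLeaves_plug_tree, plug_mapLeaves, plug_plug, funext hu]
    exact relabel_relabel (c'' := r.inColour) _ _ _ _ _ _ _ _)
  exact ⟨h, hh, tree_injective (funext fun i => by rw [tree_comp, hh, hu])⟩

end TwoLevelTree

end SetOperad

/-! ### Planar 2-level trees and their words. -/

namespace SetOperad

open PlanarTree

namespace TwoLevelTree

variable {p q r : sOp.nu.Operation}

/-- A 2-level tree is planar when the leaves of the operadic trees marking its upper vertices are
labelled in planar order. -/
def IsPlanar (f : TwoLevelTree q p) : Prop :=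
  ∀ i, (f.tree i).leaves = List.finRange (p.inColour i)

theorem isPlanar_id (p : sOp.nu.Operation) : (TwoLevelTree.id p).IsPlanar := fun i => by
  rw [leaves_tree]
  refine (leaves_relabel (c' := fun k : {k // k = i} => p.inColour k.1) (fibreIdEquiv i)
    (colour_fibreId i p.inColour) _root_.id (node () leaf)).trans ?_
  simp [leaves, List.ofFn_eq_map, ← List.flatMap_def]

theorem IsPlanar.comp {g : TwoLevelTree r q} {f : TwoLevelTree q p} (hg : g.IsPlanar)
    (hf : f.IsPlanar) : (g.comp f).IsPlanar := fun i => by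
  rw [tree_comp, leaves_plug hg, hf]

/-- The indices of the lower vertices of a 2-level tree `f : q ⟶ p` along the vertices of `q` in
preorder. -/
def word (f : TwoLevelTree q p) : List (Fin p.arity) := q.tree.vertices.map f.index

theorem index_eq_of_word_eq {f f' : TwoLevelTree q p} (h : f.word = f'.word) :
    f.index = f'.index :=
  funext fun j => List.map_inj_left.1 h j (q.isOperadic_tree.mem_vertices j)

/-- Equal words give equal index maps, so both families of planar trees cut `q` into the same
regions. -/
theorem IsPlanar.eq_of_word_eq {f f' : TwoLevelTree q p} (hf : f.IsPlanar) (hf' : f'.IsPlanar)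
    (h : f.word = f'.word) : f = f' := by
  have hi := index_eq_of_word_eq h
  refine tree_injective (funext fun i => eq_of_plug_eq_plug (ι := f.index)
    (fun i x hx => f.mem_vertices_tree.1 hx)
    (fun i x hx => hi ▸ f'.mem_vertices_tree.1 hx) hf hf'
    p.isOperadic_tree.nodup_vertices ?_ (p.isOperadic_tree.mem_vertices i))
  refine relabel_injective (c' := q.inColour) _root_.id Function.injective_id (fun _ => rfl)
    (finCongr f.out_eq).injective ?_
  exact f.mapLeaves_plug_tree.trans f'.mapLeaves_plug_tree.symm

theorem word_comp (g : TwoLevelTree r q) (f : TwoLevelTree q p) :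
    (g.comp f).word = g.word.map f.index :=
  (List.map_map (l := r.tree.vertices) (f := g.index) (g := f.index)).symm

theorem IsPlanar.insertSeen_word {g : TwoLevelTree r q} (hg : g.IsPlanar) :
    InsertSeen ∅ q.tree.vertices g.word := by
  rw [word, ← g.mapLeaves_plug_tree, mapLeaves, vertices_relabel, List.map_id]
  exact insertSeen_plug (fun i x hx => g.mem_vertices_tree.1 hx) g.vertices_tree_ne_nil hg ∅ q.tree

/-- The compatibility in (G1): precomposition here is postcomposition in the opposite category. -/
theorem IsPlanar.word_comp_lt {g : TwoLevelTree r q} (hg : g.IsPlanar) {f f' : TwoLevelTree q p}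
    (h : f.word < f'.word) : (g.comp f).word < (g.comp f').word := by
  rw [word_comp, word_comp]
  exact hg.insertSeen_word.map_lt_map (by simp) h

/-- Planarity gives corresponding upper trees the same number of leaves, so each embedding is a
substitution by planar trees. -/
theorem exists_planar_comp_eq {f : TwoLevelTree q p} {g : TwoLevelTree r p} (hf : f.IsPlanar)
    (hg : g.IsPlanar) (h : ∀ i, PlanarTree.Emb (f.upper i).1.1 (g.upper i).1.1) :
    ∃ h : TwoLevelTree r q, h.IsPlanar ∧ h.comp f = g := by
  have key i := ((h i).trans (Emb.relabel (c' := r.inColour) Subtype.val _)).exists_plug_eq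
    (t' := g.tree i) (by rw [← leaves_tree, hf, hg]) (f.upper i).1.2.nodup_vertices
    (f.upper i).1.2.mem_vertices
    (List.ne_nil_of_mem ((f.upper i).1.2.mem_vertices (f.upper i).2.some))
  choose u hu hplug using key
  -- The vertices of `q` are partitioned by the fibres of `f.index`, so the substitutions found for
  -- the separate upper trees form one family over `q`.
  obtain ⟨k, hk, hkf⟩ := exists_comp_eq f g (fun j => u (f.index j) ⟨j, rfl⟩)
    (fun j => leafCount_of_leaves_eq (hu _ _).1) (fun j => (hu _ _).2) fun i => by
      rw [← hplug i, tree]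
      refine (plug_relabel_vertices (c := q.inColour) Subtype.val _ (f.upper i).1.1).trans ?_
      refine congrArg (fun v => plug v (f.upper i).1.1) (funext ?_)
      rintro ⟨j, rfl⟩
      rfl
  exact ⟨k, fun j => by rw [hk]; exact (hu _ _).1, hkf⟩

end TwoLevelTree

/-! ### Permuting the inputs of vertices. -/

namespace Operation

/-- The operadic tree with one vertex, labelled by `i`, whose inputs are permuted by `σ`. -/
def permutedCorolla {I : Type} {c : I → ℕ} (σ : ∀ i, Equiv.Perm (Fin (c i))) (i : I) :
    PlanarTree c (Fin (c i)) := node i fun k => leaf (σ i k)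

theorem leafCount_permutedCorolla {I : Type} {c : I → ℕ} (σ : ∀ i, Equiv.Perm (Fin (c i))) (i : I)
    (k : Fin (c i)) : leafCount k (permutedCorolla σ i) = 1 := by
  simp only [permutedCorolla, leafCount]
  rw [Finset.sum_eq_single ((σ i).symm k)]
  · simp
  · intro l _ hl
    rw [if_neg]
    rintro rfl
    simp at hl
  · simp

/-- The operation obtained from `p` by permuting the inputs of the vertices. -/
def permute (p : sOp.nu.Operation) (σ : ∀ i, Equiv.Perm (Fin (p.inColour i))) :
    sOp.nu.Operation where
  arity := p.arity
  inColour := p.inColour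
  outColour := p.outColour
  op := ⟨⟨plug (permutedCorolla σ) p.tree, fun j => by
    rw [vertexCount_plug (leafCount_permutedCorolla σ), Finset.sum_eq_single j]
    · simp [p.isOperadic_tree.1, permutedCorolla, vertexCount]
    · intro i _ hi
      simp [permutedCorolla, vertexCount, hi]
    · simp, fun l => by
    rw [leafCount_plug (leafCount_permutedCorolla σ), p.isOperadic_tree.2]⟩, p.op.2⟩

theorem exists_tree_eq_permutedCorolla (p : sOp.nu.Operation)
    (σ : ∀ i, Equiv.Perm (Fin (p.inColour i))) :
    ∃ f : TwoLevelTree (p.permute σ) p, f.tree = permutedCorolla σ :=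
  TwoLevelTree.exists_tree_eq (p := p) (q := p.permute σ) (permutedCorolla σ)
    (leafCount_permutedCorolla σ) (fun _ => by simp [permutedCorolla, vertices]) rfl (relabel_refl (p.permute σ).tree)

/-- The projection from an operation with permuted inputs of vertices. -/
noncomputable def permuteHom (p : sOp.nu.Operation) (σ : ∀ i, Equiv.Perm (Fin (p.inColour i))) :
    TwoLevelTree (p.permute σ) p := (p.exists_tree_eq_permutedCorolla σ).choose

theorem tree_permuteHom (p : sOp.nu.Operation) (σ : ∀ i, Equiv.Perm (Fin (p.inColour i))) :
    (p.permuteHom σ).tree = permutedCorolla σ := (p.exists_tree_eq_permutedCorolla σ).choose_spec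

/-- Sorting the leaves of each upper tree by a permutation `σ i` makes it planar; the corolla
permuted by the inverse of `σ i` restores the original labels. -/
theorem exists_planar_comp_permuteHom_eq {q p : sOp.nu.Operation} (g : TwoLevelTree q p) :
    ∃ (σ : ∀ i, Equiv.Perm (Fin (p.inColour i))) (h : TwoLevelTree q (p.permute σ)),
      h.IsPlanar ∧ h.comp (p.permuteHom σ) = g := by
  have hop i := (g.upper i).1.2
  choose σ hσ using fun i => exists_perm_map_eq_finRange (l := (g.tree i).leaves)
    (by rw [g.leaves_tree]; exact (hop i).nodup_leaves)
    (by rw [g.leaves_tree]; exact (hop i).mem_leaves)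
  have hl i : (mapLeaves (σ i) (g.tree i)).leaves = List.finRange (p.inColour i) := by
    rw [mapLeaves, leaves_relabel, hσ]
  have hv i : (mapLeaves (σ i) (g.tree i)).vertices ≠ [] := by
    rw [mapLeaves, vertices_relabel, List.map_id]
    exact g.vertices_tree_ne_nil i
  have hp i : plug (fun i => mapLeaves (σ i) (g.tree i)) (permutedCorolla (fun i => (σ i).symm) i) =
      g.tree i := by
    rw [permutedCorolla]
    simp only [plug]
    rw [graft_leaf_eq_mapLeaves]
    refine (relabel_relabel (c'' := q.inColour) _ _ _ _ _ _ (fun _ => rfl) _).trans ?_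
    simp only [Equiv.symm_apply_apply]
    exact relabel_refl _
  obtain ⟨h, hh, hg⟩ := TwoLevelTree.exists_comp_eq (p.permuteHom fun i => (σ i).symm) g
    (fun i => mapLeaves (σ i) (g.tree i)) (fun i => leafCount_of_leaves_eq (hl i)) hv
    fun i => (congrArg (plug _) (congrFun (p.tree_permuteHom _) i)).trans (hp i)
  exact ⟨_, h, fun i => by rw [hh]; exact hl i, hg⟩

end Operation

/-! ### The Gröbner category of planar 2-level trees. -/

/-- The planar 2-level trees form a wide subcategory of the opposite of `C(nusOp)`. -/
def planar : MorphismProperty (sOp.nu.Operation)ᵒᵖ :=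
  fun _ _ f => TwoLevelTree.IsPlanar f.unop

instance : planar.IsMultiplicative where
  id_mem p := TwoLevelTree.isPlanar_id p.unop
  comp_mem _ _ hf hg := TwoLevelTree.IsPlanar.comp hg hf

theorem hasAdmissibleOrder_planar (p : WideSubcategory planar) : HasAdmissibleOrder p := by
  refine ⟨fun q f f' => TwoLevelTree.word f.hom.unop < TwoLevelTree.word f'.hom.unop,
    fun q => ?_, fun q r f f' g h => TwoLevelTree.IsPlanar.word_comp_lt g.property h⟩
  -- All words of morphisms between two fixed operations have the same length and a finite alphabet,
  -- so the lexicographic order on them is a finite linear order, hence a well-order.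
  have : Finite {l : List (Fin p.obj.unop.arity) // l.length = q.obj.unop.tree.vertices.length} :=
    (List.finite_length_eq _ _).to_subtype
  let w (f : p ⟶ q) :
      {l : List (Fin p.obj.unop.arity) // l.length = q.obj.unop.tree.vertices.length} :=
    ⟨TwoLevelTree.word f.hom.unop, List.length_map _⟩
  have hw : w.Injective := fun f f' h => WideSubcategory.hom_ext _ (Quiver.Hom.unop_inj
    (TwoLevelTree.IsPlanar.eq_of_word_eq f.property f'.property (congrArg Subtype.val h)))
  exact (RelEmbedding.preimage ⟨w, hw⟩ (· < ·)).isWellOrder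

theorem isNoetherianPoset_planar (p : WideSubcategory planar) :
    IsNoetherianPoset (UnderPoset p) := by
  intro x
  let y n := ofAntisymmetrization (· ≤ ·) (x n)
  -- A finite product of well-quasi-orders is one, so a single pair `m < n` works for all vertices
  -- of `p` at once.
  obtain ⟨m, n, hmn, h⟩ := WellQuasiOrdered.pi
    (fun i => LeafLabelledTree.wellQuasiOrdered_emb (L := Fin (p.obj.unop.inColour i)))
    fun n i => ⟨(TwoLevelTree.upper (y n).hom.hom.unop i).1.1⟩
  obtain ⟨k, hk, hkf⟩ := TwoLevelTree.exists_planar_comp_eq (y m).hom.property (y n).hom.property h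
  refine ⟨m, n, hmn, ofAntisymmetrization_le_ofAntisymmetrization_iff.1 ?_⟩
  exact ⟨⟨Quiver.Hom.op k, hk⟩, WideSubcategory.hom_ext _ (Quiver.Hom.unop_inj hkf)⟩

theorem propertyF_planar : PropertyF (wideSubcategoryInclusion planar) := by
  intro p
  let e := Fintype.equivFin (∀ i, Equiv.Perm (Fin (p.unop.inColour i)))
  refine ⟨_, fun k => ⟨Opposite.op (p.unop.permute (e.symm k))⟩,
    fun k => Quiver.Hom.op (p.unop.permuteHom (e.symm k)), fun q g => ?_⟩
  obtain ⟨σ, h, hh, hg⟩ := Operation.exists_planar_comp_permuteHom_eq g.unop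
  obtain ⟨k, rfl⟩ := e.symm.surjective σ
  exact ⟨k, ⟨Quiver.Hom.op h, hh⟩, Quiver.Hom.unop_inj hg⟩

end SetOperad

theorem mainTheorem4 : IsQuasiGrobner (sOp.nu.Operation)ᵒᵖ :=
  ⟨WideSubcategory SetOperad.planar, inferInstance, wideSubcategoryInclusion SetOperad.planar,
    fun p => ⟨SetOperad.hasAdmissibleOrder_planar p, SetOperad.isNoetherianPoset_planar p⟩,
    ⟨fun p => ⟨⟨p⟩, ⟨Iso.refl p⟩⟩⟩, SetOperad.propertyF_planar⟩
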